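/- **Conventions.** All Lie algebras are real and finite dimensional. A pseudo-Euclidean Lie algebra is a Lie algebra $(\mathfrak g,[\;,\;])$ with a nondegenerate symmetric bilinear form $\langle\;,\;\rangle$; it is Euclidean if the form is positive definite and Lorentzian if the form has exactly one negative direction (is $\mathrm{diag}(1,\dots,1,-1)$ in a suitable basis). Isomorphisms are isometric Lie algebra isomorphisms, and products carry the product bracket and the orthogonal sum of the metrics. The Levi-Civita product is given by $2\langle \mathrm L_uv,w\rangle=\langle[u,v],w\rangle+\langle[w,u],v\rangle+\langle[w,v],u\rangle$, the curvature by $\mathrm K(u,v)=\mathrm L_{[u,v]}-[\mathrm L_u,\mathrm L_v]$, and the Ricci operator $\mathrm{Ric}$ by $\langle\mathrm{Ric}(u),v\rangle=\mathrm{tr}(w\mapsto \mathrm K(u,w)v)$. The algebra is $\alpha$-Einstein if $\mathrm{Ric}=\alpha\,\mathrm{Id}$, Ricci-parallel if $\mathrm L_u\circ\mathrm{Ric}=\mathrm{Ric}\circ\mathrm L_u$ for all $u$, and has harmonic curvature if $\mathrm{Ric}$ is a Codazzi operator, i.e. $A=\mathrm{Ric}$ is symmetric and $$\langle\mathrm L_uv,A(w)\rangle+\langle\mathrm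 L_uw,A(v)\rangle=\langle\mathrm L_vu,A(w)\rangle+\langle\mathrm L_vw,A(u)\rangle\quad\text{for all }u,v,w.$$ An operator $f$ is of type $\{n-2,z\bar z\}$ if in some basis its matrix is $\mathrm{diag}(\alpha_1,\dots,\alpha_{n-2})\oplus\begin{pmatrix}a&b\\-b&a\end{pmatrix}$ with $b\ne0$ and the matrix of the metric is $I_{n-2}\oplus\begin{pmatrix}0&1\\1&0\end{pmatrix}$. For $\alpha<0$ let $\langle\;,\;\rangle_\alpha$ be the metric on $\mathrm{sl}(2,\mathbb R)$ whose matrix in the basis $$X_1=\begin{pmatrix}0&1\\-1&0\end{pmatrix},\quad X_2=\begin{pmatrix}0&1\\1&0\end{pmatrix},\quad X_3=\begin{pmatrix}1&0\\0&-1\end{pmatrix}\qquad\text{is}\qquad -\frac8\alpha\begin{pmatrix}1&0&-1\\0&1&0\\-1&0&0\end{pmatrix}.$$ **Theorem.** Let $(\mathfrak g,[\;,\;],\langle\;,\;\rangle)$ be a Lorentzian Lie algebra of dimension $\ge3$ whose Ricci operator is of type $\{n-2,z\bar z\}$, $n=\dim\mathfrak g$, and has $\alpha$ as its only real eigenvalue.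 Then $\mathfrak g$ has harmonic curvature if and only if one of the following holds: 1. $\dim\mathfrak g=3$, $\alpha<0$, and $\mathfrak g$ is isomorphic to $(\mathrm{sl}(2,\mathbb R),\langle\;,\;\rangle_\alpha)$; 2. $\dim\mathfrak g>3$, $\alpha<0$, and $\mathfrak g$ is isomorphic to the product of $(\mathrm{sl}(2,\mathbb R),\langle\;,\;\rangle_\alpha)$ with a Euclidean $\alpha$-Einstein Lie algebra. Moreover, if $\mathfrak g$ has harmonic curvature (that is, in both cases), it is not Ricci-parallel. -/

import Mathlib

universe u v

/-- A pseudo-Euclidean metric on a real vector space: a nondegenerate symmetric bilinear form.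
A pseudo-Euclidean Lie algebra is a real Lie algebra with such a metric. -/
structure PseudoEuclideanMetric (V : Type u) [AddCommGroup V] [Module ℝ V] where
  form : LinearMap.BilinForm ℝ V
  symm : form.IsSymm
  nondeg : form.Nondegenerate

namespace PseudoEuclideanMetric

section Linear

variable {V : Type u} [AddCommGroup V] [Module ℝ V]

/-- The metric is positive definite. -/
def IsEuclidean (M : PseudoEuclideanMetric V) : Prop :=
  ∀ x : V, x ≠ 0 → 0 < M.form x x

/-- The metric is Lorentzian: a maximal negative definite subspace has dimension one
(so that a maximal positive definite subspace has codimension one). -/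
def IsLorentzian (M : PseudoEuclideanMetric V) : Prop :=
  sigNeg (LinearMap.BilinMap.toQuadraticMap M.form) = 1

/-- The operator `f` is symmetric with respect to the metric. -/
def IsSymmetricOperator (M : PseudoEuclideanMetric V) (f : Module.End ℝ V) : Prop :=
  ∀ x y : V, M.form (f x) y = M.form x (f y)

/-- The operator `f` is of type `{n-2, z z̄}`: in some basis its matrix is
`diag(α₁, …, αₙ₋₂) ⊕ [[a, b], [-b, a]]` with `b ≠ 0`, and the matrix of the metric is
`Iₙ₋₂ ⊕ [[0, 1], [1, 0]]`. -/
def IsTypeZZ (M : PseudoEuclideanMetric V) (f : Module.End ℝ V) : Prop :=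
  ∃ (m : ℕ) (β : Module.Basis (Fin m ⊕ Fin 2) ℝ V) (αs : Fin m → ℝ) (a b : ℝ),
    b ≠ 0 ∧
    LinearMap.toMatrix β β f =
      Matrix.fromBlocks (Matrix.diagonal αs) 0 0 !![a, b; -b, a] ∧
    LinearMap.BilinForm.toMatrix β M.form =
      Matrix.fromBlocks 1 0 0 !![0, 1; 1, 0]

/-- The orthogonal direct sum of two metrics. -/
noncomputable def prod {W : Type v} [AddCommGroup W] [Module ℝ W]
    (M : PseudoEuclideanMetric V) (N : PseudoEuclideanMetric W) : PseudoEuclideanMetric (V × W) where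
  form := M.form.compl₁₂ (LinearMap.fst ℝ V W) (LinearMap.fst ℝ V W) +
    N.form.compl₁₂ (LinearMap.snd ℝ V W) (LinearMap.snd ℝ V W)
  symm := ⟨fun x y => by
    simp [M.symm.eq x.1 y.1, N.symm.eq x.2 y.2]⟩
  nondeg := by
    constructor
    · rintro ⟨x, y⟩ h
      have hx : x = 0 := M.nondeg.1 x fun z => by simpa using h (z, 0)
      have hy : y = 0 := N.nondeg.1 y fun z => by simpa using h (0, z)
      simp [hx, hy]
    · rintro ⟨x, y⟩ h
      have hx : x = 0 := M.nondeg.2 x fun z => by simpa using h (z, 0)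
      have hy : y = 0 := N.nondeg.2 y fun z => by simpa using h (0, z)
      simp [hx, hy]

end Linear

section LieAlg

variable {g : Type u} [LieRing g] [LieAlgebra ℝ g]

/-- Two pseudo-Euclidean Lie algebras are isomorphic: there is an isomorphism of Lie algebras
that is an isometry. -/
def Isomorphic {h : Type v} [LieRing h] [LieAlgebra ℝ h]
    (M : PseudoEuclideanMetric g) (N : PseudoEuclideanMetric h) : Prop :=
  ∃ φ : g ≃ₗ⁅ℝ⁆ h, ∀ x y : g, N.form (φ x) (φ y) = M.form x y

variable [FiniteDimensional ℝ g]

/-- The linear form `w ↦ (⟨[u,v],w⟩ + ⟨[w,u],v⟩ + ⟨[w,v],u⟩) / 2` of Koszul's formula. -/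
noncomputable def koszul (M : PseudoEuclideanMetric g) (u v : g) : Module.Dual ℝ g where
  toFun w := (M.form ⁅u, v⁆ w + M.form ⁅w, u⁆ v + M.form ⁅w, v⁆ u) / 2
  map_add' x y := by simp; ring
  map_smul' r x := by simp; ring

/-- The Levi-Civita product `L`, with `leviCivita u v = L_u v`, defined by Koszul's formula. -/
noncomputable def leviCivita (M : PseudoEuclideanMetric g) : g →ₗ[ℝ] Module.End ℝ g :=
  LinearMap.mk₂ ℝ (fun u v => (M.form.toDual M.nondeg).symm (M.koszul u v))
    (fun u₁ u₂ v => by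
      rw [← map_add]; congr 1; ext w; simp [koszul]; ring)
    (fun r u v => by
      rw [← map_smul]; congr 1; ext w; simp [koszul]; ring)
    (fun u v₁ v₂ => by
      rw [← map_add]; congr 1; ext w; simp [koszul]; ring)
    (fun r u v => by
      rw [← map_smul]; congr 1; ext w; simp [koszul]; ring)

/-- Koszul's formula. -/
theorem two_mul_form_leviCivita (M : PseudoEuclideanMetric g) (u v w : g) :
    2 * M.form (M.leviCivita u v) w =
      M.form ⁅u, v⁆ w + M.form ⁅w, u⁆ v + M.form ⁅w, v⁆ u := by
  simp [leviCivita, LinearMap.BilinForm.apply_toDual_symm_apply, koszul]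
  ring

/-- The curvature `K(u,v) = L_[u,v] - [L_u, L_v]`. -/
noncomputable def curvature (M : PseudoEuclideanMetric g) (u v : g) : Module.End ℝ g :=
  M.leviCivita ⁅u, v⁆ -
    (M.leviCivita u * M.leviCivita v - M.leviCivita v * M.leviCivita u)

/-- The endomorphism `w ↦ K(u,w)v`. -/
noncomputable def curvatureEnd (M : PseudoEuclideanMetric g) (u v : g) : Module.End ℝ g where
  toFun w := M.curvature u w v
  map_add' x y := by simp [curvature]; abel
  map_smul' r x := by simp [curvature, smul_sub]

/-- The Ricci curvature `ric(u,v) = tr(w ↦ K(u,w)v)`. -/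
noncomputable def ricci (M : PseudoEuclideanMetric g) : LinearMap.BilinForm ℝ g :=
  LinearMap.mk₂ ℝ (fun u v => LinearMap.trace ℝ g (M.curvatureEnd u v))
    (fun u₁ u₂ v => by
      rw [← map_add]; congr 1; ext w; simp [curvatureEnd, curvature]; abel)
    (fun r u v => by
      rw [← map_smul]; congr 1; ext w; simp [curvatureEnd, curvature, smul_sub])
    (fun u v₁ v₂ => by
      rw [← map_add]; congr 1; ext w; simp [curvatureEnd])
    (fun r u v => by
      rw [← map_smul]; congr 1; ext w; simp [curvatureEnd])

/-- The Ricci operator, determined by `⟨Ric u, v⟩ = ric(u,v)`. -/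
noncomputable def ricciOp (M : PseudoEuclideanMetric g) : Module.End ℝ g :=
  (M.form.toDual M.nondeg).symm.toLinearMap ∘ₗ M.ricci

theorem form_ricciOp (M : PseudoEuclideanMetric g) (u v : g) :
    M.form (M.ricciOp u) v = M.ricci u v := by
  simp [ricciOp, LinearMap.BilinForm.apply_toDual_symm_apply]

/-- `A` is a Codazzi operator: it is symmetric and
`⟨L_u v, A w⟩ + ⟨L_u w, A v⟩ = ⟨L_v u, A w⟩ + ⟨L_v w, A u⟩`. -/
def IsCodazzi (M : PseudoEuclideanMetric g) (A : Module.End ℝ g) : Prop :=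
  M.IsSymmetricOperator A ∧ ∀ u v w : g,
    M.form (M.leviCivita u v) (A w) + M.form (M.leviCivita u w) (A v) =
      M.form (M.leviCivita v u) (A w) + M.form (M.leviCivita v w) (A u)

/-- The curvature is harmonic: the Ricci operator is a Codazzi operator. -/
def HasHarmonicCurvature (M : PseudoEuclideanMetric g) : Prop :=
  M.IsCodazzi M.ricciOp

/-- The Ricci tensor is parallel, `∇ Ric = 0`: one has `L_u (Ric v) = Ric (L_u v)` for all
`u` and `v`. -/
def IsRicciParallel (M : PseudoEuclideanMetric g) : Prop :=
  ∀ u v : g, M.leviCivita u (M.ricciOp v) = M.ricciOp (M.leviCivita u v)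

/-- The pseudo-Euclidean Lie algebra is `α`-Einstein: `Ric = α Id`. -/
def IsEinstein (M : PseudoEuclideanMetric g) (α : ℝ) : Prop :=
  M.ricciOp = α • (1 : Module.End ℝ g)

end LieAlg

end PseudoEuclideanMetric

/-- The Lie algebra `sl(2,ℝ)` of traceless real `2 × 2` matrices. -/
abbrev SlTwo : Type := LieAlgebra.SpecialLinear.sl (Fin 2) ℝ

namespace SlTwo

theorem mem_iff (A : Matrix (Fin 2) (Fin 2) ℝ) :
    A ∈ LieAlgebra.SpecialLinear.sl (Fin 2) ℝ ↔ A 0 0 + A 1 1 = 0 := by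
  change Matrix.trace A = 0 ↔ _
  rw [Matrix.trace_fin_two]

/-- The basis `X₁ = [[0,1],[-1,0]]`, `X₂ = [[0,1],[1,0]]`, `X₃ = [[1,0],[0,-1]]`, given through
coordinates: `x₁ X₁ + x₂ X₂ + x₃ X₃ = [[x₃, x₁ + x₂], [x₂ - x₁, -x₃]]`. -/
noncomputable def basis : Module.Basis (Fin 3) ℝ SlTwo :=
  Module.Basis.ofEquivFun
    { toFun := fun A => ![(A.1 0 1 - A.1 1 0) / 2, (A.1 0 1 + A.1 1 0) / 2, A.1 0 0]
      invFun := fun x => ⟨!![x 2, x 0 + x 1; x 1 - x 0, -x 2], by rw [mem_iff]; simp⟩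
      map_add' := fun A B => by
        ext i; fin_cases i <;> simp <;> ring
      map_smul' := fun r A => by
        ext i; fin_cases i <;> simp <;> ring
      left_inv := fun A => by
        have h : A.1 0 0 + A.1 1 1 = 0 := (mem_iff A.1).1 A.2
        ext i j
        fin_cases i <;> fin_cases j <;> simp <;> linarith
      right_inv := fun x => by
        ext i; fin_cases i <;> simp <;> ring }

theorem basis_zero : (basis 0 : SlTwo).1 = !![0, 1; -1, 0] := by
  simp [basis]

theorem basis_one : (basis 1 : SlTwo).1 = !![0, 1; 1, 0] := by
  simp [basis]

theorem basis_two : (basis 2 : SlTwo).1 = !![1, 0; 0, -1] := by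
  simp [basis]

/-- The metric on `sl(2,ℝ)` whose matrix in the basis `(X₁, X₂, X₃)` is
`-(8/α) [[1,0,-1],[0,1,0],[-1,0,0]]`, where `α < 0`. -/
noncomputable def metric (α : ℝ) (hα : α < 0) : PseudoEuclideanMetric SlTwo where
  form := Matrix.toBilin basis ((-(8 / α)) • !![1, 0, -1; 0, 1, 0; -1, 0, 0])
  symm := by
    rw [LinearMap.BilinForm.isSymm_iff_basis basis]
    intro i j
    fin_cases i <;> fin_cases j <;> simp [Fin.sum_univ_three]
  nondeg := by
    have h := hα.ne
    apply LinearMap.BilinForm.nondegenerate_of_det_ne_zero (b := basis)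
    simp [Matrix.det_fin_three, h]

end SlTwo

/-!
Write `α`, `z = a + ib` and `z̄` for the eigenvalues of `Ric`, let `e`, `f` be null vectors with
`⟨e, f⟩ = 1` spanning the plane `P` that belongs to `z` and `z̄`, and let `V = P^⊥` be the
`α`-eigenspace, on which the metric is positive definite.

Suppose the curvature is harmonic. The Codazzi equation, evaluated on eigenvectors, shows that
`V` is totally geodesic, that `L_P P ⊆ V`, and that for `u ∈ V` all plane components of
`L_u e`, `L_u f`, `L_e u`, `L_f u` are fixed multiples of one number `c(u)`, which is itself a
multiple of `⟨x, u⟩` with `x = [e, f] ∈ V` (`leviCivita_mem_perp`, `form_leviCivita_null`,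
`form_lie_null`). What is left of `ad e` and `ad f` on `V` are two skew-symmetric operators `S`, `T`
of `V`. The Jacobi identity gives `S x = T x = 0` and writes `[S, ad x]` and `[T, ad x]` as
combinations of `S` and `T`; since `tr(S [S, ad x]) = 0` and so on, `tr(S²) + tr(T²) = 0`, and both
terms are nonpositive because `V` is Euclidean, so `S = T = 0` (`perpAd_null_eq_zero`). This needs
`x ≠ 0`, which holds since otherwise `e` would be parallel and `⟨Ric e, e⟩ = -b` would vanish
(`lie_null_ne_zero`).

Consequently `e`, `f`, `x` span an ideal that commutes with its orthogonal complement `H`, which is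
an ideal as well. Computing `Ric` on the span of `e`, `f`, `x` (`ricci_eq`) and comparing with its
eigenvalues determines all structure constants (`constants`), and they are those of
`sl(2,ℝ)` with the metric `⟨ , ⟩_α` (`exists_slTwo_hom`). The factor `H` is Euclidean, and it is
`α`-Einstein because `H ⊆ V`.

The converse is a computation on `sl(2,ℝ)`, as products of algebras with harmonic curvature have
harmonic curvature and Einstein metrics are among them. Finally `L_x e = (α / 2) e` while
`L_x f = -(α / 2) f`, so `L_x` does not commute with `Ric` (`not_isRicciParallel`).
-/

/-! ### Levi-Civita product, isometries and products -/

namespace PseudoEuclideanMetric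

section General

variable {V : Type u} [AddCommGroup V] [Module ℝ V]

theorem form_comm (M : PseudoEuclideanMetric V) (x y : V) : M.form x y = M.form y x :=
  M.symm.eq x y

theorem eq_of_form_eq (M : PseudoEuclideanMetric V) {x y : V}
    (h : ∀ w, M.form x w = M.form y w) : x = y := by
  rw [← sub_eq_zero]
  exact M.nondeg.1 _ fun w => by simp [h w]

theorem prod_form_apply {W : Type v} [AddCommGroup W] [Module ℝ W] (M : PseudoEuclideanMetric V)
    (N : PseudoEuclideanMetric W) (x y : V × W) :
    (M.prod N).form x y = M.form x.1 y.1 + N.form x.2 y.2 := rfl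

end General

section LeviCivita

variable {g : Type u} [LieRing g] [LieAlgebra ℝ g] [FiniteDimensional ℝ g]

theorem leviCivita_eq_of_koszul (M : PseudoEuclideanMetric g) {u v x : g}
    (h : ∀ w, 2 * M.form x w = M.form ⁅u, v⁆ w + M.form ⁅w, u⁆ v + M.form ⁅w, v⁆ u) :
    M.leviCivita u v = x :=
  M.eq_of_form_eq fun w => by linarith [h w, M.two_mul_form_leviCivita u v w]

/-- The operators `L_u` are skew-symmetric: the Levi-Civita product is metric. -/
theorem form_leviCivita_skew (M : PseudoEuclideanMetric g) (u v w : g) :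
    M.form (M.leviCivita u v) w = -M.form (M.leviCivita u w) v := by
  have h₁ := M.two_mul_form_leviCivita u v w
  have h₂ := M.two_mul_form_leviCivita u w v
  rw [← lie_skew v u, ← lie_skew w u, ← lie_skew w v] at *
  simp only [map_neg, LinearMap.neg_apply] at *
  linarith

theorem form_leviCivita_self (M : PseudoEuclideanMetric g) (u w : g) :
    M.form (M.leviCivita u w) w = 0 := by
  linarith [M.form_leviCivita_skew u w w]

/-- The Levi-Civita product is torsion-free. -/
theorem leviCivita_sub_leviCivita (M : PseudoEuclideanMetric g) (u v : g) :
    M.leviCivita u v - M.leviCivita v u = ⁅u, v⁆ := by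
  refine M.eq_of_form_eq fun w => ?_
  have h₁ := M.two_mul_form_leviCivita u v w
  have h₂ := M.two_mul_form_leviCivita v u w
  rw [← lie_skew v u] at h₂
  simp only [map_neg, LinearMap.neg_apply, map_sub, LinearMap.sub_apply] at *
  linarith

theorem curvature_apply (M : PseudoEuclideanMetric g) (u v w : g) :
    M.curvature u v w = M.leviCivita ⁅u, v⁆ w -
      (M.leviCivita u (M.leviCivita v w) - M.leviCivita v (M.leviCivita u w)) := rfl

theorem ricci_apply (M : PseudoEuclideanMetric g) (u v : g) :
    M.ricci u v = LinearMap.trace ℝ g (M.curvatureEnd u v) := rfl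

theorem curvatureEnd_apply (M : PseudoEuclideanMetric g) (u v w : g) :
    M.curvatureEnd u v w = M.curvature u w v := rfl

theorem ricciOp_eq_of_ricci (M : PseudoEuclideanMetric g) {u x : g}
    (h : ∀ w, M.form x w = M.ricci u w) : M.ricciOp u = x :=
  M.eq_of_form_eq fun w => by rw [form_ricciOp, h]

/-- The Codazzi equation for `A - α Id`, in terms of `⟨L_u v, w⟩` only. -/
theorem IsCodazzi.shift {M : PseudoEuclideanMetric g} {A : Module.End ℝ g} (hA : M.IsCodazzi A)
    (α : ℝ) (u v w : g) :
    M.form (M.leviCivita u v) (A w - α • w) - M.form (M.leviCivita u (A v - α • v)) w =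
      M.form (M.leviCivita v u) (A w - α • w) - M.form (M.leviCivita v (A u - α • u)) w := by
  have h := hA.2 u v w
  rw [M.form_leviCivita_skew u w (A v), M.form_leviCivita_skew v w (A u)] at h
  simp only [map_sub, map_smul, LinearMap.sub_apply, LinearMap.smul_apply, smul_eq_mul]
  linarith

theorem IsEinstein.hasHarmonicCurvature {M : PseudoEuclideanMetric g} {α : ℝ}
    (h : M.IsEinstein α) : M.HasHarmonicCurvature := by
  rw [IsEinstein] at h
  rw [HasHarmonicCurvature, h]
  constructor
  · intro x y
    simp
  · intro u v w
    have h₁ := M.form_leviCivita_skew u v w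
    have h₂ := M.form_leviCivita_skew v u w
    simp only [LinearMap.smul_apply, Module.End.one_apply, map_smul, smul_eq_mul]
    rw [h₁, h₂]
    ring

end LeviCivita

section Isometry

variable {g : Type u} [LieRing g] [LieAlgebra ℝ g] [FiniteDimensional ℝ g]
variable {h : Type v} [LieRing h] [LieAlgebra ℝ h] [FiniteDimensional ℝ h]
variable {M : PseudoEuclideanMetric g} {N : PseudoEuclideanMetric h}

theorem leviCivita_map (φ : g ≃ₗ⁅ℝ⁆ h) (hφ : ∀ x y, N.form (φ x) (φ y) = M.form x y) (u v : g) :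
    N.leviCivita (φ u) (φ v) = φ (M.leviCivita u v) := by
  refine N.leviCivita_eq_of_koszul fun w => ?_
  obtain ⟨w, rfl⟩ : ∃ w', φ w' = w := φ.surjective w
  simp only [← LieEquiv.map_lie, hφ]
  exact M.two_mul_form_leviCivita u v w

theorem ricci_map (φ : g ≃ₗ⁅ℝ⁆ h) (hφ : ∀ x y, N.form (φ x) (φ y) = M.form x y) (u v : g) :
    N.ricci (φ u) (φ v) = M.ricci u v := by
  rw [ricci_apply, ricci_apply, ← LinearMap.trace_conj' _ φ.toLinearEquiv]
  congr 1
  refine LinearMap.ext fun w => ?_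
  obtain ⟨w, rfl⟩ : ∃ w', φ w' = w := φ.surjective w
  have hs : φ.toLinearEquiv.symm (φ w) = w := φ.symm_apply_apply w
  rw [LinearEquiv.conj_apply_apply, hs, curvatureEnd_apply, curvatureEnd_apply, curvature_apply,
    curvature_apply, ← LieEquiv.map_lie]
  simp only [leviCivita_map φ hφ]
  exact ((map_sub φ _ _).trans (congrArg _ (map_sub φ _ _))).symm

theorem ricciOp_map (φ : g ≃ₗ⁅ℝ⁆ h) (hφ : ∀ x y, N.form (φ x) (φ y) = M.form x y) (u : g) :
    N.ricciOp (φ u) = φ (M.ricciOp u) := by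
  refine N.ricciOp_eq_of_ricci fun w => ?_
  obtain ⟨w, rfl⟩ : ∃ w', φ w' = w := φ.surjective w
  rw [hφ, ricci_map φ hφ, form_ricciOp]

theorem Isomorphic.hasHarmonicCurvature (hMN : M.Isomorphic N) (hN : N.HasHarmonicCurvature) :
    M.HasHarmonicCurvature := by
  obtain ⟨φ, hφ⟩ := hMN
  constructor
  · intro x y
    have := hN.1 (φ x) (φ y)
    rwa [ricciOp_map φ hφ, ricciOp_map φ hφ, hφ, hφ] at this
  · intro u v w
    have := hN.2 (φ u) (φ v) (φ w)
    simpa only [ricciOp_map φ hφ, leviCivita_map φ hφ, hφ] using this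

end Isometry

section Product

variable {g : Type u} [LieRing g] [LieAlgebra ℝ g] [FiniteDimensional ℝ g]
variable {h : Type v} [LieRing h] [LieAlgebra ℝ h] [FiniteDimensional ℝ h]
variable (M : PseudoEuclideanMetric g) (N : PseudoEuclideanMetric h)

theorem leviCivita_prod (x y : g × h) :
    (M.prod N).leviCivita x y = (M.leviCivita x.1 y.1, N.leviCivita x.2 y.2) := by
  refine (M.prod N).leviCivita_eq_of_koszul fun w => ?_
  simp only [prod_form_apply, LieAlgebra.Prod.bracket_apply]
  linarith [M.two_mul_form_leviCivita x.1 y.1 w.1, N.two_mul_form_leviCivita x.2 y.2 w.2]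

theorem ricci_prod (x y : g × h) :
    (M.prod N).ricci x y = M.ricci x.1 y.1 + N.ricci x.2 y.2 := by
  rw [ricci_apply, ricci_apply, ricci_apply, ← LinearMap.trace_prodMap']
  congr 1
  refine LinearMap.ext fun w => ?_
  simp only [LinearMap.prodMap_apply, curvatureEnd_apply, curvature_apply, leviCivita_prod,
    LieAlgebra.Prod.bracket_apply, Prod.mk_sub_mk]

theorem ricciOp_prod (x : g × h) :
    (M.prod N).ricciOp x = (M.ricciOp x.1, N.ricciOp x.2) :=
  (M.prod N).ricciOp_eq_of_ricci fun w => by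
    rw [prod_form_apply, ricci_prod, form_ricciOp, form_ricciOp]

variable {M N} in
theorem HasHarmonicCurvature.prod (hM : M.HasHarmonicCurvature) (hN : N.HasHarmonicCurvature) :
    (M.prod N).HasHarmonicCurvature := by
  constructor
  · intro x y
    simp only [ricciOp_prod, prod_form_apply]
    rw [hM.1 x.1 y.1, hN.1 x.2 y.2]
  · intro x y z
    simp only [ricciOp_prod, leviCivita_prod, prod_form_apply]
    linarith [hM.2 x.1 y.1 z.1, hN.2 x.2 y.2 z.2]

end Product

end PseudoEuclideanMetric

/-! ### The curvature of the metrics on `sl(2,ℝ)` -/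

namespace SlTwo

/-- The element `x₁ X₁ + x₂ X₂ + x₃ X₃` of `sl(2,ℝ)`. -/
noncomputable def ofCoords (x : Fin 3 → ℝ) : SlTwo :=
  basis.equivFun.symm x

theorem ofCoords_val (x : Fin 3 → ℝ) :
    (ofCoords x).1 = !![x 2, x 0 + x 1; x 1 - x 0, -x 2] := by
  simp [ofCoords, basis]

theorem ofCoords_surjective : Function.Surjective ofCoords :=
  basis.equivFun.symm.surjective

theorem basis_repr_ofCoords (x : Fin 3 → ℝ) (i : Fin 3) : basis.repr (ofCoords x) i = x i := by
  rw [← Module.Basis.equivFun_apply, ofCoords, LinearEquiv.apply_symm_apply]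

theorem basis_eq_ofCoords (i : Fin 3) : basis i = ofCoords (Pi.single i 1) := by
  rw [ofCoords, Module.Basis.equivFun_symm_apply, Finset.sum_eq_single i] <;> simp +contextual

theorem lie_ofCoords (x y : Fin 3 → ℝ) :
    ⁅ofCoords x, ofCoords y⁆ = ofCoords ![-2 * (x 1 * y 2 - x 2 * y 1),
      -2 * (x 0 * y 2 - x 2 * y 0), 2 * (x 0 * y 1 - x 1 * y 0)] := by
  apply Subtype.ext
  change (ofCoords x).1 * (ofCoords y).1 - (ofCoords y).1 * (ofCoords x).1 = _
  rw [ofCoords_val, ofCoords_val, ofCoords_val]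
  ext i j
  fin_cases i <;> fin_cases j <;> simp <;> ring

section Metric

variable (α : ℝ) (hα : α < 0)

theorem metric_form_ofCoords (x y : Fin 3 → ℝ) :
    (metric α hα).form (ofCoords x) (ofCoords y) =
      -(8 / α) * (x 0 * y 0 - x 0 * y 2 - x 2 * y 0 + x 1 * y 1) := by
  simp only [metric, Matrix.toBilin_apply, basis_repr_ofCoords, Fin.sum_univ_three]
  simp
  ring

theorem leviCivita_ofCoords (x y : Fin 3 → ℝ) :
    (metric α hα).leviCivita (ofCoords x) (ofCoords y) =
      ofCoords ![-2 * x 0 * y 1 - 2 * x 1 * y 0 + 2 * x 2 * y 1,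
        2 * x 0 * y 0 - 2 * x 0 * y 2 + 2 * x 2 * y 2,
        -2 * x 1 * y 0 + 2 * x 1 * y 2 + 2 * x 2 * y 1] := by
  refine (metric α hα).leviCivita_eq_of_koszul fun w => ?_
  obtain ⟨w, rfl⟩ := ofCoords_surjective w
  simp only [lie_ofCoords, metric_form_ofCoords]
  simp
  ring

theorem ricci_ofCoords (x y : Fin 3 → ℝ) :
    (metric α hα).ricci (ofCoords x) (ofCoords y) =
      8 * x 0 * y 0 - 8 * x 1 * y 1 - 8 * x 2 * y 2 := by
  rw [PseudoEuclideanMetric.ricci_apply, LinearMap.trace_eq_matrix_trace ℝ basis, Matrix.trace,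
    Fin.sum_univ_three]
  simp only [Matrix.diag_apply, LinearMap.toMatrix_apply, basis_eq_ofCoords,
    PseudoEuclideanMetric.curvatureEnd_apply, PseudoEuclideanMetric.curvature_apply,
    lie_ofCoords, leviCivita_ofCoords, map_sub, Finsupp.sub_apply, basis_repr_ofCoords]
  simp
  ring

theorem ricciOp_ofCoords (x : Fin 3 → ℝ) :
    (metric α hα).ricciOp (ofCoords x) =
      ofCoords ![-α * x 2, α * x 1, α * x 0 - α * x 2] := by
  refine (metric α hα).ricciOp_eq_of_ricci fun w => ?_
  obtain ⟨w, rfl⟩ := ofCoords_surjective w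
  rw [metric_form_ofCoords, ricci_ofCoords]
  have := hα.ne
  simp
  field_simp
  ring

theorem hasHarmonicCurvature_metric : (metric α hα).HasHarmonicCurvature := by
  have := hα.ne
  constructor
  · intro x y
    obtain ⟨x, rfl⟩ := ofCoords_surjective x
    obtain ⟨y, rfl⟩ := ofCoords_surjective y
    simp only [ricciOp_ofCoords, metric_form_ofCoords]
    simp [-mul_eq_mul_left_iff]
    ring
  · intro x y z
    obtain ⟨x, rfl⟩ := ofCoords_surjective x
    obtain ⟨y, rfl⟩ := ofCoords_surjective y
    obtain ⟨z, rfl⟩ := ofCoords_surjective z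
    simp only [ricciOp_ofCoords, leviCivita_ofCoords, metric_form_ofCoords]
    simp
    ring

end Metric

end SlTwo

/-! ### Codazzi operators of type `{n-2, z z̄}` -/

namespace PseudoEuclideanMetric

section Frame

variable {V : Type u} [AddCommGroup V] [Module ℝ V]

/-- The subspace of vectors orthogonal to both `e` and `f`. -/
def perp (M : PseudoEuclideanMetric V) (e f : V) : Submodule ℝ V :=
  LinearMap.ker (M.form e) ⊓ LinearMap.ker (M.form f)

theorem mem_perp {M : PseudoEuclideanMetric V} {e f y : V} :
    y ∈ M.perp e f ↔ M.form y e = 0 ∧ M.form y f = 0 := by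
  rw [M.form_comm y, M.form_comm y]
  rfl

/-- A frame adapted to an operator `A` of type `{n-2, z z̄}` with single real eigenvalue `α`, where
`z = a + ib`: the vectors `e`, `f` are null with `⟨e, f⟩ = 1`, and they span the plane on which `A`
has the eigenvalues `z` and `z̄`; the `v i` are an orthonormal basis of the orthogonal complement of
this plane, on which `A` is `α Id`. The fields `expand` and `trace` express that these vectors
form a basis. -/
structure IsZZFrame (M : PseudoEuclideanMetric V) (A : Module.End ℝ V) (α a b : ℝ) {n : ℕ}
    (v : Fin n → V) (e f : V) : Prop where
  b_ne : b ≠ 0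
  ee : M.form e e = 0
  ff : M.form f f = 0
  ef : M.form e f = 1
  ve : ∀ i, M.form (v i) e = 0
  vf : ∀ i, M.form (v i) f = 0
  vv : ∀ i j, M.form (v i) (v j) = if i = j then 1 else 0
  expand : ∀ y, y = ∑ i, M.form y (v i) • v i + (M.form y f • e + M.form y e • f)
  trace : ∀ F : Module.End ℝ V, LinearMap.trace ℝ V F =
    ∑ i, M.form (F (v i)) (v i) + (M.form (F e) f + M.form (F f) e)
  Ae : A e = a • e - b • f
  Af : A f = b • e + a • f
  Av : ∀ i, A (v i) = α • v i

theorem IsTypeZZ.exists_isZZFrame {M : PseudoEuclideanMetric V} {A : Module.End ℝ V}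
    (h : M.IsTypeZZ A) {α : ℝ} (hα : ∀ r : ℝ, Module.End.HasEigenvalue A r → r = α) :
    ∃ (n : ℕ) (a b : ℝ) (v : Fin n → V) (e f : V), M.IsZZFrame A α a b v e f := by
  obtain ⟨n, β, αs, a, b, hb, hA, hG⟩ := h
  have hform : ∀ i j, M.form (β i) (β j) =
      (Matrix.fromBlocks (1 : Matrix (Fin n) (Fin n) ℝ) 0 0 !![0, 1; 1, 0]) i j := fun i j => by
    rw [← hG, LinearMap.BilinForm.toMatrix_apply]
  have hop : ∀ j, A (β j) = ∑ i, (Matrix.fromBlocks (Matrix.diagonal αs) 0 0 !![a, b; -b, a]) i j •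
      β i := fun j => by
    rw [← hA]
    conv_lhs => rw [← β.sum_repr (A (β j))]
    simp only [LinearMap.toMatrix_apply]
  have hv : ∀ i, A (β (.inl i)) = αs i • β (.inl i) := fun i => by
    rw [hop, Fintype.sum_sum_type]
    simp [Matrix.diagonal_apply]
  have hαs : ∀ i, αs i = α := fun i =>
    hα _ (Module.End.hasEigenvalue_of_hasEigenvector
      ⟨Module.End.mem_eigenspace_iff.2 (hv i), β.ne_zero _⟩)
  have ee : M.form (β (.inr 0)) (β (.inr 0)) = 0 := by simp [hform]
  have ff : M.form (β (.inr 1)) (β (.inr 1)) = 0 := by simp [hform]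
  have ef : M.form (β (.inr 0)) (β (.inr 1)) = 1 := by simp [hform]
  have fe : M.form (β (.inr 1)) (β (.inr 0)) = 1 := by simp [hform]
  have ve : ∀ i, M.form (β (.inl i)) (β (.inr 0)) = 0 := fun i => by simp [hform]
  have vf : ∀ i, M.form (β (.inl i)) (β (.inr 1)) = 0 := fun i => by simp [hform]
  have vv : ∀ i j, M.form (β (.inl i)) (β (.inl j)) = if i = j then 1 else 0 := fun i j => by
    simp [hform, Matrix.one_apply]
  have hsum : ∀ y, y = ∑ i, β.repr y (.inl i) • β (.inl i) +
      (β.repr y (.inr 0) • β (.inr 0) + β.repr y (.inr 1) • β (.inr 1)) := fun y => by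
    conv_lhs => rw [← β.sum_repr y]
    rw [Fintype.sum_sum_type, Fin.sum_univ_two]
  have rv : ∀ y i, β.repr y (.inl i) = M.form y (β (.inl i)) := fun y i => by
    conv_rhs => rw [hsum y]
    simp [vv, M.form_comm _ (β (.inl i)), ve, vf]
  have re : ∀ y, β.repr y (.inr 0) = M.form y (β (.inr 1)) := fun y => by
    conv_rhs => rw [hsum y]
    simp [vf, ef, ff]
  have rf : ∀ y, β.repr y (.inr 1) = M.form y (β (.inr 0)) := fun y => by
    conv_rhs => rw [hsum y]
    simp [ve, fe, ee]
  refine ⟨n, a, b, fun i => β (.inl i), β (.inr 0), β (.inr 1), hb, ee, ff, ef, ve, vf, vv,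
    fun y => ?_, fun F => ?_, ?_, ?_, fun i => by rw [hv, hαs]⟩
  · simpa only [rv, re, rf] using hsum y
  · rw [LinearMap.trace_eq_matrix_trace ℝ β, Matrix.trace, Fintype.sum_sum_type, Fin.sum_univ_two]
    simp only [Matrix.diag_apply, LinearMap.toMatrix_apply, rv, re, rf]
  · rw [hop, Fintype.sum_sum_type]
    simp [sub_eq_add_neg]
  · rw [hop, Fintype.sum_sum_type]
    simp

end Frame

namespace IsZZFrame

section Linear

variable {V : Type u} [AddCommGroup V] [Module ℝ V] {M : PseudoEuclideanMetric V}
  {A : Module.End ℝ V} {α a b : ℝ} {n : ℕ} {v : Fin n → V} {e f : V}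

theorem fe (F : M.IsZZFrame A α a b v e f) : M.form f e = 1 := by
  rw [M.form_comm, F.ef]

/-- Exchanging the two null vectors replaces `z` by its conjugate. -/
theorem swap (F : M.IsZZFrame A α a b v e f) : M.IsZZFrame A α a (-b) v f e where
  b_ne := neg_ne_zero.2 F.b_ne
  ee := F.ff
  ff := F.ee
  ef := F.fe
  ve := F.vf
  vf := F.ve
  vv := F.vv
  expand y := by rw [add_comm (M.form y e • f)]; exact F.expand y
  trace G := by rw [add_comm (M.form (G f) e)]; exact F.trace G
  Ae := by rw [F.Af, neg_smul, sub_neg_eq_add, add_comm]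
  Af := by rw [F.Ae, neg_smul, sub_eq_add_neg, add_comm]
  Av := F.Av

theorem mem_perp_v (F : M.IsZZFrame A α a b v e f) (i : Fin n) : v i ∈ M.perp e f :=
  mem_perp.2 ⟨F.ve i, F.vf i⟩

theorem ext (F : M.IsZZFrame A α a b v e f) {y z : V} (he : M.form y e = M.form z e)
    (hf : M.form y f = M.form z f) (hv : ∀ u ∈ M.perp e f, M.form y u = M.form z u) : y = z := by
  rw [F.expand y, F.expand z, he, hf]
  simp only [hv _ (F.mem_perp_v _)]

theorem eq_sum_of_mem_perp (F : M.IsZZFrame A α a b v e f) {u : V} (hu : u ∈ M.perp e f) :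
    u = ∑ i, M.form u (v i) • v i := by
  rw [mem_perp] at hu
  conv_lhs => rw [F.expand u, hu.1, hu.2]
  simp

theorem apply_of_mem_perp (F : M.IsZZFrame A α a b v e f) {u : V} (hu : u ∈ M.perp e f) :
    A u = α • u := by
  rw [F.eq_sum_of_mem_perp hu, map_sum, Finset.smul_sum]
  exact Finset.sum_congr rfl fun i _ => by rw [map_smul, F.Av, smul_comm]

theorem form_eq_sum_of_mem_perp (F : M.IsZZFrame A α a b v e f) {u : V} (hu : u ∈ M.perp e f)
    (w : V) : M.form u w = ∑ i, M.form u (v i) * M.form (v i) w := by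
  conv_lhs => rw [F.eq_sum_of_mem_perp hu]
  simp

theorem form_self_nonneg (F : M.IsZZFrame A α a b v e f) {u : V} (hu : u ∈ M.perp e f) :
    0 ≤ M.form u u := by
  rw [F.form_eq_sum_of_mem_perp hu]
  exact Finset.sum_nonneg fun i _ => by rw [M.form_comm (v i) u]; exact mul_self_nonneg _

theorem eq_zero_of_form_self (F : M.IsZZFrame A α a b v e f) {u : V} (hu : u ∈ M.perp e f)
    (h : M.form u u = 0) : u = 0 := by
  rw [F.form_eq_sum_of_mem_perp hu, Finset.sum_eq_zero_iff_of_nonneg] at h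
  · rw [F.eq_sum_of_mem_perp hu]
    refine Finset.sum_eq_zero fun i hi => ?_
    have := h i hi
    rw [M.form_comm (v i) u, mul_self_eq_zero] at this
    rw [this, zero_smul]
  · exact fun i _ => by rw [M.form_comm (v i) u]; exact mul_self_nonneg _

theorem form_self_pos (F : M.IsZZFrame A α a b v e f) {u : V} (hu : u ∈ M.perp e f)
    (h : u ≠ 0) : 0 < M.form u u :=
  (F.form_self_nonneg hu).lt_of_ne fun h0 => h (F.eq_zero_of_form_self hu h0.symm)

theorem eq_smul_add_smul (F : M.IsZZFrame A α a b v e f) {y : V}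
    (hy : ∀ u ∈ M.perp e f, M.form y u = 0) : y = M.form y f • e + M.form y e • f := by
  conv_lhs => rw [F.expand y]
  simp [hy _ (F.mem_perp_v _)]

theorem Ae_sub (F : M.IsZZFrame A α a b v e f) : A e - α • e = (a - α) • e - b • f := by
  rw [F.Ae]; module

theorem Af_sub (F : M.IsZZFrame A α a b v e f) : A f - α • f = b • e + (a - α) • f := by
  rw [F.Af]; module

theorem sub_of_mem_perp (F : M.IsZZFrame A α a b v e f) {u : V} (hu : u ∈ M.perp e f) :
    A u - α • u = 0 := by
  rw [F.apply_of_mem_perp hu, sub_self]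

theorem norm_pos (F : M.IsZZFrame A α a b v e f) : 0 < (a - α) ^ 2 + b ^ 2 := by
  have := F.b_ne
  positivity

/-- With `w = (a - α) + i b`, the constants `l` and `m` are the real and imaginary parts of
`1 - w̄ / w`, and `w̄ / w` has modulus one. -/
theorem circle (F : M.IsZZFrame A α a b v e f) {l m : ℝ}
    (hl : l * ((a - α) ^ 2 + b ^ 2) = 2 * b ^ 2)
    (hm : m * ((a - α) ^ 2 + b ^ 2) = 2 * (a - α) * b) : m ^ 2 + (1 - l) ^ 2 = 1 := by
  have hN := F.norm_pos.ne'
  have : ((a - α) ^ 2 + b ^ 2) ^ 2 * (m ^ 2 + (1 - l) ^ 2 - 1) = 0 := by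
    linear_combination (l * ((a - α) ^ 2 + b ^ 2) + 2 * b ^ 2 - 2 * ((a - α) ^ 2 + b ^ 2)) * hl +
      (m * ((a - α) ^ 2 + b ^ 2) + 2 * (a - α) * b) * hm
  have := (mul_eq_zero.1 this).resolve_left (pow_ne_zero 2 hN)
  linarith

end Linear

section Codazzi

variable {g : Type u} [LieRing g] [LieAlgebra ℝ g] [FiniteDimensional ℝ g]
  {M : PseudoEuclideanMetric g} {A : Module.End ℝ g} {α a b : ℝ} {n : ℕ} {v : Fin n → g} {e f : g}

/-- The `α`-eigenspace is totally geodesic. -/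
theorem leviCivita_mem_perp (F : M.IsZZFrame A α a b v e f) (hA : M.IsCodazzi A) {u w : g}
    (hu : u ∈ M.perp e f) (hw : w ∈ M.perp e f) : M.leviCivita u w ∈ M.perp e f := by
  have h₁ := hA.shift α u e w
  have h₂ := hA.shift α u f w
  rw [F.sub_of_mem_perp hu, F.sub_of_mem_perp hw, F.Ae_sub] at h₁
  rw [F.sub_of_mem_perp hu, F.sub_of_mem_perp hw, F.Af_sub] at h₂
  simp only [map_sub, map_add, map_smul, map_zero, LinearMap.sub_apply, LinearMap.add_apply,
    LinearMap.smul_apply, LinearMap.zero_apply, smul_eq_mul] at h₁ h₂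
  have hN := F.norm_pos.ne'
  rw [mem_perp, M.form_leviCivita_skew u w e, M.form_leviCivita_skew u w f, neg_eq_zero,
    neg_eq_zero]
  constructor <;> refine (mul_eq_zero.1 ?_).resolve_left hN
  · linear_combination -(a - α) * h₁ - b * h₂
  · linear_combination b * h₁ - (a - α) * h₂

theorem lie_mem_perp (F : M.IsZZFrame A α a b v e f) (hA : M.IsCodazzi A) {u w : g}
    (hu : u ∈ M.perp e f) (hw : w ∈ M.perp e f) : ⁅u, w⁆ ∈ M.perp e f := by
  rw [← M.leviCivita_sub_leviCivita]
  exact sub_mem (F.leviCivita_mem_perp hA hu hw) (F.leviCivita_mem_perp hA hw hu)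

theorem leviCivita_perp_e (F : M.IsZZFrame A α a b v e f) (hA : M.IsCodazzi A) {u : g}
    (hu : u ∈ M.perp e f) : M.leviCivita u e = M.form (M.leviCivita u e) f • e := by
  conv_lhs => rw [F.eq_smul_add_smul (y := M.leviCivita u e) fun w hw => by
    rw [M.form_leviCivita_skew, (mem_perp.1 (F.leviCivita_mem_perp hA hu hw)).1, neg_zero]]
  rw [form_leviCivita_self, zero_smul, add_zero]

theorem leviCivita_perp_f (F : M.IsZZFrame A α a b v e f) (hA : M.IsCodazzi A) {u : g}
    (hu : u ∈ M.perp e f) : M.leviCivita u f = -M.form (M.leviCivita u e) f • f := by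
  conv_lhs => rw [F.eq_smul_add_smul (y := M.leviCivita u f) fun w hw => by
    rw [M.form_leviCivita_skew, (mem_perp.1 (F.leviCivita_mem_perp hA hu hw)).2, neg_zero]]
  rw [form_leviCivita_self, zero_smul, zero_add, M.form_leviCivita_skew u f e]

/-- The Codazzi equation determines the plane components of `L_e u` and `L_f u` by those
of `L_u e`. -/
theorem form_leviCivita_null (F : M.IsZZFrame A α a b v e f) (hA : M.IsCodazzi A) {l m : ℝ}
    (hl : l * ((a - α) ^ 2 + b ^ 2) = 2 * b ^ 2)
    (hm : m * ((a - α) ^ 2 + b ^ 2) = 2 * (a - α) * b) {u : g} (hu : u ∈ M.perp e f) :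
    M.form (M.leviCivita e u) e = -m * M.form (M.leviCivita u e) f ∧
    M.form (M.leviCivita e u) f = l * M.form (M.leviCivita u e) f ∧
    M.form (M.leviCivita f u) e = -l * M.form (M.leviCivita u e) f ∧
    M.form (M.leviCivita f u) f = -m * M.form (M.leviCivita u e) f := by
  have h₁ := hA.shift α u e e
  have h₂ := hA.shift α u e f
  have h₃ := hA.shift α u f e
  have h₄ := hA.shift α u f f
  have hs := M.form_leviCivita_skew u f e
  have he := form_leviCivita_self M u e
  have hf := form_leviCivita_self M u f
  rw [F.sub_of_mem_perp hu, F.Ae_sub] at h₁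
  rw [F.sub_of_mem_perp hu, F.Ae_sub, F.Af_sub] at h₂ h₃
  rw [F.sub_of_mem_perp hu, F.Af_sub] at h₄
  simp only [map_sub, map_add, map_smul, map_zero, LinearMap.sub_apply, LinearMap.add_apply,
    LinearMap.smul_apply, LinearMap.zero_apply, smul_eq_mul, hs, he, hf] at h₁ h₂ h₃ h₄
  have hN := F.norm_pos.ne'
  refine ⟨?_, ?_, ?_, ?_⟩ <;> refine mul_left_cancel₀ hN ?_
  · linear_combination -(a - α) * h₁ - b * h₂ + M.form (M.leviCivita u e) f * hm
  · linear_combination b * h₁ - (a - α) * h₂ - M.form (M.leviCivita u e) f * hl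
  · linear_combination -(a - α) * h₃ - b * h₄ + M.form (M.leviCivita u e) f * hl
  · linear_combination b * h₃ - (a - α) * h₄ + M.form (M.leviCivita u e) f * hm

/-- The plane spanned by `e` and `f` has no connection coefficients of its own. -/
theorem leviCivita_null_mem_perp (F : M.IsZZFrame A α a b v e f) (hA : M.IsCodazzi A) :
    M.leviCivita e e ∈ M.perp e f ∧ M.leviCivita e f ∈ M.perp e f ∧
    M.leviCivita f e ∈ M.perp e f ∧ M.leviCivita f f ∈ M.perp e f := by
  have h₁ := hA.shift α e f e
  have h₂ := hA.shift α e f f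
  have hs := M.form_leviCivita_skew e f e
  have hs' := M.form_leviCivita_skew f f e
  have he := form_leviCivita_self M e e
  have hf := form_leviCivita_self M e f
  have he' := form_leviCivita_self M f e
  have hf' := form_leviCivita_self M f f
  rw [F.Ae_sub, F.Af_sub] at h₁ h₂
  simp only [map_sub, map_add, map_smul, LinearMap.sub_apply, LinearMap.add_apply,
    LinearMap.smul_apply, smul_eq_mul, hs, hs', he, hf, he', hf'] at h₁ h₂
  have h₃ : M.form (M.leviCivita e e) f = 0 := by
    refine (mul_eq_zero.1 ?_).resolve_left F.b_ne
    linarith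
  have h₄ : M.form (M.leviCivita f e) f = 0 := by
    refine (mul_eq_zero.1 ?_).resolve_left F.b_ne
    linarith
  simp only [mem_perp]
  refine ⟨⟨he, h₃⟩, ⟨?_, hf⟩, ⟨he', h₄⟩, ⟨?_, hf'⟩⟩ <;> linarith

end Codazzi

end IsZZFrame

end PseudoEuclideanMetric

/-! ### Vanishing of the mixed brackets -/

namespace PseudoEuclideanMetric

section Compression

/-- The orthogonal projection onto `M.perp e f`, for null vectors with `⟨e, f⟩ = 1`. -/
noncomputable def perpProj {V : Type u} [AddCommGroup V] [Module ℝ V]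
    (M : PseudoEuclideanMetric V) (e f : V) : Module.End ℝ V :=
  LinearMap.id - (M.form f).smulRight e - (M.form e).smulRight f

theorem perpProj_apply {V : Type u} [AddCommGroup V] [Module ℝ V]
    (M : PseudoEuclideanMetric V) (e f y : V) :
    M.perpProj e f y = y - M.form y f • e - M.form y e • f := by
  rw [M.form_comm y f, M.form_comm y e]
  rfl

/-- The compression of `ad y` to `M.perp e f`, extended by zero to the plane spanned by
`e` and `f`. -/
noncomputable def perpAd {g : Type u} [LieRing g] [LieAlgebra ℝ g]
    (M : PseudoEuclideanMetric g) (e f y : g) : Module.End ℝ g :=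
  M.perpProj e f * LieAlgebra.ad ℝ g y * M.perpProj e f

theorem perpAd_apply {g : Type u} [LieRing g] [LieAlgebra ℝ g]
    (M : PseudoEuclideanMetric g) (e f y u : g) :
    M.perpAd e f y u = M.perpProj e f ⁅y, M.perpProj e f u⁆ := rfl

end Compression

namespace IsZZFrame

section Projection

variable {V : Type u} [AddCommGroup V] [Module ℝ V] {M : PseudoEuclideanMetric V}
  {A : Module.End ℝ V} {α a b : ℝ} {n : ℕ} {v : Fin n → V} {e f : V}

theorem perpProj_mem (F : M.IsZZFrame A α a b v e f) (y : V) : M.perpProj e f y ∈ M.perp e f := by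
  rw [mem_perp, perpProj_apply]
  simp [F.ee, F.ef, F.fe, F.ff]

theorem perpProj_of_mem {u : V} (hu : u ∈ M.perp e f) : M.perpProj e f u = u := by
  rw [mem_perp] at hu
  rw [perpProj_apply, hu.1, hu.2]
  simp

theorem perpProj_e (F : M.IsZZFrame A α a b v e f) : M.perpProj e f e = 0 := by
  rw [perpProj_apply, F.ee, F.ef]
  simp

theorem perpProj_f (F : M.IsZZFrame A α a b v e f) : M.perpProj e f f = 0 := by
  rw [perpProj_apply, F.ff, F.fe]
  simp

theorem form_perpProj (y : V) {u : V} (hu : u ∈ M.perp e f) :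
    M.form (M.perpProj e f y) u = M.form y u := by
  rw [mem_perp] at hu
  rw [perpProj_apply, M.form_comm _ u]
  simp [hu.1, hu.2, M.form_comm u y]

/-- Two endomorphisms agree if they agree on `M.perp e f` and both vanish on `e` and `f`. -/
theorem end_ext (F : M.IsZZFrame A α a b v e f) {S T : Module.End ℝ V}
    (h : ∀ u ∈ M.perp e f, S u = T u) (hSe : S e = 0) (hTe : T e = 0) (hSf : S f = 0)
    (hTf : T f = 0) : S = T := by
  refine LinearMap.ext fun y => ?_
  rw [F.expand y]
  simp [hSe, hTe, hSf, hTf, h _ (F.mem_perp_v _)]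

/-- For an operator on `M.perp e f` that is skew-symmetric, `tr(S²) ≤ 0`, with equality
only if `S = 0`. -/
theorem trace_sq_nonpos (F : M.IsZZFrame A α a b v e f) {S : Module.End ℝ V}
    (hS : ∀ y, S y ∈ M.perp e f)
    (hskew : ∀ u ∈ M.perp e f, ∀ w ∈ M.perp e f, M.form (S u) w = -M.form (S w) u)
    (hSe : S e = 0) (hSf : S f = 0) :
    LinearMap.trace ℝ V (S * S) ≤ 0 ∧ (LinearMap.trace ℝ V (S * S) = 0 → S = 0) := by
  have key : LinearMap.trace ℝ V (S * S) = -∑ i, M.form (S (v i)) (S (v i)) := by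
    rw [F.trace, ← Finset.sum_neg_distrib]
    simp only [Module.End.mul_apply, hSe, hSf, map_zero, LinearMap.zero_apply, add_zero]
    exact Finset.sum_congr rfl fun i _ => hskew _ (hS _) _ (F.mem_perp_v i)
  have hnn : ∀ i ∈ Finset.univ, 0 ≤ M.form (S (v i)) (S (v i)) := fun i _ =>
    F.form_self_nonneg (hS _)
  rw [key]
  refine ⟨neg_nonpos.2 (Finset.sum_nonneg hnn), fun h => ?_⟩
  rw [neg_eq_zero, Finset.sum_eq_zero_iff_of_nonneg hnn] at h
  refine F.end_ext (fun u hu => ?_) hSe rfl hSf rfl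
  rw [F.eq_sum_of_mem_perp hu, map_sum]
  refine Finset.sum_eq_zero fun i hi => ?_
  rw [map_smul, F.eq_zero_of_form_self (hS _) (h i hi), smul_zero]

end Projection

section Compression

variable {g : Type u} [LieRing g] [LieAlgebra ℝ g] {M : PseudoEuclideanMetric g}
  {A : Module.End ℝ g} {α a b : ℝ} {n : ℕ} {v : Fin n → g} {e f : g}

theorem perpAd_mem (F : M.IsZZFrame A α a b v e f) (y u : g) : M.perpAd e f y u ∈ M.perp e f :=
  F.perpProj_mem _

theorem perpAd_of_mem (y : g) {u : g} (hu : u ∈ M.perp e f) :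
    M.perpAd e f y u = M.perpProj e f ⁅y, u⁆ := by
  rw [perpAd_apply, perpProj_of_mem hu]

theorem perpAd_e (F : M.IsZZFrame A α a b v e f) (y : g) : M.perpAd e f y e = 0 := by
  rw [perpAd_apply, F.perpProj_e, lie_zero, map_zero]

theorem perpAd_f (F : M.IsZZFrame A α a b v e f) (y : g) : M.perpAd e f y f = 0 := by
  rw [perpAd_apply, F.perpProj_f, lie_zero, map_zero]

end Compression

section Algebra

variable {g : Type u} [LieRing g] [LieAlgebra ℝ g] [FiniteDimensional ℝ g]
  {M : PseudoEuclideanMetric g} {A : Module.End ℝ g} {α a b : ℝ} {n : ℕ} {v : Fin n → g} {e f : g}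

theorem perpAd_skew_e (F : M.IsZZFrame A α a b v e f) (hA : M.IsCodazzi A) :
    ∀ u ∈ M.perp e f, ∀ w ∈ M.perp e f,
      M.form (M.perpAd e f e u) w = -M.form (M.perpAd e f e w) u := by
  have key : ∀ u ∈ M.perp e f, ∀ w ∈ M.perp e f,
      M.form (M.perpAd e f e u) w = M.form (M.leviCivita e u) w := fun u hu w hw => by
    rw [perpAd_of_mem e hu, form_perpProj _ hw, ← M.leviCivita_sub_leviCivita,
      F.leviCivita_perp_e hA hu]
    simp [M.form_comm e w, (mem_perp.1 hw).1]
  intro u hu w hw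
  rw [key u hu w hw, key w hw u hu, M.form_leviCivita_skew]

theorem perpAd_skew_f (F : M.IsZZFrame A α a b v e f) (hA : M.IsCodazzi A) :
    ∀ u ∈ M.perp e f, ∀ w ∈ M.perp e f,
      M.form (M.perpAd e f f u) w = -M.form (M.perpAd e f f w) u := by
  have key : ∀ u ∈ M.perp e f, ∀ w ∈ M.perp e f,
      M.form (M.perpAd e f f u) w = M.form (M.leviCivita f u) w := fun u hu w hw => by
    rw [perpAd_of_mem f hu, form_perpProj _ hw, ← M.leviCivita_sub_leviCivita,
      F.leviCivita_perp_f hA hu]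
    simp [M.form_comm f w, (mem_perp.1 hw).2]
  intro u hu w hw
  rw [key u hu w hw, key w hw u hu, M.form_leviCivita_skew]

theorem lie_null_mem_perp (F : M.IsZZFrame A α a b v e f) (hA : M.IsCodazzi A) :
    ⁅e, f⁆ ∈ M.perp e f := by
  obtain ⟨-, h₁, h₂, -⟩ := F.leviCivita_null_mem_perp hA
  rw [← M.leviCivita_sub_leviCivita]
  exact sub_mem h₁ h₂

variable {l m : ℝ}

theorem form_lie_null (F : M.IsZZFrame A α a b v e f) (hA : M.IsCodazzi A)
    (hl : l * ((a - α) ^ 2 + b ^ 2) = 2 * b ^ 2)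
    (hm : m * ((a - α) ^ 2 + b ^ 2) = 2 * (a - α) * b) {u : g} (hu : u ∈ M.perp e f) :
    M.form ⁅e, f⁆ u = -(2 * l) * M.form (M.leviCivita u e) f := by
  obtain ⟨-, h₁, h₂, -⟩ := F.form_leviCivita_null hA hl hm hu
  rw [← M.leviCivita_sub_leviCivita, map_sub, LinearMap.sub_apply, M.form_leviCivita_skew e f u,
    M.form_leviCivita_skew f e u, h₁, h₂]
  ring

theorem lie_perp_e (F : M.IsZZFrame A α a b v e f) (hA : M.IsCodazzi A)
    (hl : l * ((a - α) ^ 2 + b ^ 2) = 2 * b ^ 2)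
    (hm : m * ((a - α) ^ 2 + b ^ 2) = 2 * (a - α) * b) {u : g} (hu : u ∈ M.perp e f) :
    ⁅u, e⁆ = ((1 - l) * M.form (M.leviCivita u e) f) • e + (m * M.form (M.leviCivita u e) f) • f -
      M.perpAd e f e u := by
  obtain ⟨h₁, h₂, -, -⟩ := F.form_leviCivita_null hA hl hm hu
  have h₃ : M.form ⁅e, u⁆ f = -((1 - l) * M.form (M.leviCivita u e) f) := by
    rw [← M.leviCivita_sub_leviCivita, map_sub, LinearMap.sub_apply, h₂]
    ring
  have h₄ : M.form ⁅e, u⁆ e = -(m * M.form (M.leviCivita u e) f) := by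
    rw [← M.leviCivita_sub_leviCivita, map_sub, LinearMap.sub_apply, h₁, form_leviCivita_self]
    ring
  rw [perpAd_of_mem e hu, perpProj_apply, h₃, h₄, ← lie_skew e u]
  module

theorem lie_perp_f (F : M.IsZZFrame A α a b v e f) (hA : M.IsCodazzi A)
    (hl : l * ((a - α) ^ 2 + b ^ 2) = 2 * b ^ 2)
    (hm : m * ((a - α) ^ 2 + b ^ 2) = 2 * (a - α) * b) {u : g} (hu : u ∈ M.perp e f) :
    ⁅u, f⁆ = (m * M.form (M.leviCivita u e) f) • e - ((1 - l) * M.form (M.leviCivita u e) f) • f -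
      M.perpAd e f f u := by
  obtain ⟨-, -, h₁, h₂⟩ := F.form_leviCivita_null hA hl hm hu
  have h₃ : M.form ⁅f, u⁆ f = -(m * M.form (M.leviCivita u e) f) := by
    rw [← M.leviCivita_sub_leviCivita, map_sub, LinearMap.sub_apply, h₂, form_leviCivita_self]
    ring
  have h₄ : M.form ⁅f, u⁆ e = (1 - l) * M.form (M.leviCivita u e) f := by
    rw [← M.leviCivita_sub_leviCivita, map_sub, LinearMap.sub_apply, h₁,
      M.form_leviCivita_skew u f e]
    ring
  rw [perpAd_of_mem f hu, perpProj_apply, h₃, h₄, ← lie_skew f u]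
  module

/-- The plane component of the Jacobi identity for `u`, `e`, `f` shows that the compressions of
`ad e` and `ad f` annihilate `⁅e, f⁆`. -/
theorem perpAd_null_lie (F : M.IsZZFrame A α a b v e f) (hA : M.IsCodazzi A)
    (hl : l * ((a - α) ^ 2 + b ^ 2) = 2 * b ^ 2)
    (hm : m * ((a - α) ^ 2 + b ^ 2) = 2 * (a - α) * b) :
    M.perpAd e f e ⁅e, f⁆ = 0 ∧ M.perpAd e f f ⁅e, f⁆ = 0 := by
  have hx := F.lie_null_mem_perp hA
  have key : ∀ u ∈ M.perp e f, M.form (M.leviCivita (M.perpAd e f e u) e) f = 0 ∧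
      M.form (M.leviCivita (M.perpAd e f f u) e) f = 0 := fun u hu => by
    have hj : ⁅u, ⁅e, f⁆⁆ = ⁅⁅u, e⁆, f⁆ + ⁅e, ⁅u, f⁆⁆ := leibniz_lie u e f
    rw [F.lie_perp_e hA hl hm hu, F.lie_perp_f hA hl hm hu] at hj
    simp only [sub_lie, add_lie, smul_lie, lie_sub, lie_smul, lie_self, smul_zero] at hj
    rw [← lie_skew e (M.perpAd e f f u), F.lie_perp_e hA hl hm (F.perpAd_mem f u),
      F.lie_perp_f hA hl hm (F.perpAd_mem e u)] at hj
    have hux := mem_perp.1 (F.lie_mem_perp hA hu hx)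
    have h₀ := mem_perp.1 hx
    have h₁ := mem_perp.1 (F.perpAd_mem f (M.perpAd e f e u))
    have h₂ := mem_perp.1 (F.perpAd_mem e (M.perpAd e f f u))
    have he := congrArg (fun y => M.form y e) hj
    have hf := congrArg (fun y => M.form y f) hj
    simp only [map_add, map_sub, map_neg, map_smul, LinearMap.add_apply, LinearMap.sub_apply,
      LinearMap.neg_apply, LinearMap.smul_apply, smul_eq_mul, F.ee, F.ef, F.fe, F.ff, hux.1, hux.2,
      h₀.1, h₀.2, h₁.1, h₁.2, h₂.1, h₂.2, map_zero, LinearMap.zero_apply] at he hf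
    have hc := F.circle hl hm
    constructor
    · linear_combination (-M.form (M.leviCivita (M.perpAd e f e u) e) f) * hc -
        (1 - l) * he + m * hf
    · linear_combination (-M.form (M.leviCivita (M.perpAd e f f u) e) f) * hc -
        m * he - (1 - l) * hf
  constructor
  · refine F.eq_zero_of_form_self (F.perpAd_mem _ _) ?_
    rw [F.perpAd_skew_e hA _ hx _ (F.perpAd_mem _ _), M.form_comm,
      F.form_lie_null hA hl hm (F.perpAd_mem _ _), (key _ (F.perpAd_mem _ _)).1]
    ring
  · refine F.eq_zero_of_form_self (F.perpAd_mem _ _) ?_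
    rw [F.perpAd_skew_f hA _ hx _ (F.perpAd_mem _ _), M.form_comm,
      F.form_lie_null hA hl hm (F.perpAd_mem _ _), (key _ (F.perpAd_mem _ _)).2]
    ring

/-- The Jacobi identity for `⁅e, f⁆`, `w` and one of `e`, `f`. -/
theorem perpAd_commutator (F : M.IsZZFrame A α a b v e f) (hA : M.IsCodazzi A)
    (hl : l * ((a - α) ^ 2 + b ^ 2) = 2 * b ^ 2)
    (hm : m * ((a - α) ^ 2 + b ^ 2) = 2 * (a - α) * b) {s : ℝ}
    (hs : M.form (M.leviCivita ⁅e, f⁆ e) f = s) :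
    M.perpAd e f e * M.perpAd e f ⁅e, f⁆ - M.perpAd e f ⁅e, f⁆ * M.perpAd e f e =
      -s • ((1 - l) • M.perpAd e f e + m • M.perpAd e f f) ∧
    M.perpAd e f f * M.perpAd e f ⁅e, f⁆ - M.perpAd e f ⁅e, f⁆ * M.perpAd e f f =
      -s • (m • M.perpAd e f e - (1 - l) • M.perpAd e f f) := by
  have hx := F.lie_null_mem_perp hA
  obtain ⟨hxe, hxf⟩ := F.perpAd_null_lie hA hl hm
  have hE : ∀ w ∈ M.perp e f, M.perpAd e f ⁅e, f⁆ w = ⁅⁅e, f⁆, w⁆ := fun w hw => by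
    rw [perpAd_of_mem _ hw, perpProj_of_mem (F.lie_mem_perp hA hx hw)]
  have hLe := F.lie_perp_e hA hl hm hx
  have hLf := F.lie_perp_f hA hl hm hx
  rw [hxe, sub_zero, hs] at hLe
  rw [hxf, sub_zero, hs] at hLf
  have hD : ∀ y, ∀ w ∈ M.perp e f, M.perpProj e f ⁅w, y⁆ = -M.perpAd e f y w := fun y w hw => by
    rw [perpAd_of_mem _ hw, ← lie_skew, map_neg]
  constructor
  · refine F.end_ext (fun w hw => ?_) (by simp [F.perpAd_e]) (by simp [F.perpAd_e])
      (by simp [F.perpAd_f]) (by simp [F.perpAd_f])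
    have hj : ⁅⁅e, f⁆, ⁅w, e⁆⁆ = ⁅⁅⁅e, f⁆, w⁆, e⁆ + ⁅w, ⁅⁅e, f⁆, e⁆⁆ := leibniz_lie _ _ _
    rw [F.lie_perp_e hA hl hm hw, hLe] at hj
    simp only [lie_sub, lie_add, lie_smul] at hj
    rw [hLe, hLf, ← hE _ (F.perpAd_mem e w), ← hE w hw] at hj
    have := congrArg (M.perpProj e f) hj
    simp only [map_add, map_sub, map_smul, F.perpProj_e, F.perpProj_f, hD _ w hw,
      hD _ _ (F.perpAd_mem _ w), perpProj_of_mem (F.perpAd_mem _ _), smul_zero] at this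
    simp only [LinearMap.sub_apply, LinearMap.add_apply, LinearMap.smul_apply,
      Module.End.mul_apply]
    linear_combination (norm := module) this
  · refine F.end_ext (fun w hw => ?_) (by simp [F.perpAd_e]) (by simp [F.perpAd_e])
      (by simp [F.perpAd_f]) (by simp [F.perpAd_f])
    have hj : ⁅⁅e, f⁆, ⁅w, f⁆⁆ = ⁅⁅⁅e, f⁆, w⁆, f⁆ + ⁅w, ⁅⁅e, f⁆, f⁆⁆ := leibniz_lie _ _ _
    rw [F.lie_perp_f hA hl hm hw, hLf] at hj
    simp only [lie_sub, lie_smul] at hj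
    rw [hLe, hLf, ← hE _ (F.perpAd_mem f w), ← hE w hw] at hj
    have := congrArg (M.perpProj e f) hj
    simp only [map_add, map_sub, map_smul, F.perpProj_e, F.perpProj_f, hD _ w hw,
      hD _ _ (F.perpAd_mem _ w), perpProj_of_mem (F.perpAd_mem _ _), smul_zero] at this
    simp only [LinearMap.sub_apply, LinearMap.smul_apply, Module.End.mul_apply]
    linear_combination (norm := module) this

/-- The trace form is invariant and negative definite on skew-symmetric operators, so the
commutation relations of `perpAd_commutator` force the compressions of `ad e` and `ad f`
to vanish. -/
theorem perpAd_null_eq_zero (F : M.IsZZFrame A α a b v e f) (hA : M.IsCodazzi A)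
    (hl : l * ((a - α) ^ 2 + b ^ 2) = 2 * b ^ 2)
    (hm : m * ((a - α) ^ 2 + b ^ 2) = 2 * (a - α) * b)
    (hs : M.form (M.leviCivita ⁅e, f⁆ e) f ≠ 0) :
    M.perpAd e f e = 0 ∧ M.perpAd e f f = 0 := by
  obtain ⟨h₁, h₂⟩ := F.perpAd_commutator hA hl hm rfl
  obtain ⟨hP, hP0⟩ := F.trace_sq_nonpos (F.perpAd_mem e) (F.perpAd_skew_e hA) (F.perpAd_e e)
    (F.perpAd_f e)
  obtain ⟨hR, hR0⟩ := F.trace_sq_nonpos (F.perpAd_mem f) (F.perpAd_skew_f hA) (F.perpAd_e f)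
    (F.perpAd_f f)
  have hc := F.circle hl hm
  generalize M.form (M.leviCivita ⁅e, f⁆ e) f = s at *
  generalize M.perpAd e f e = S at *
  generalize M.perpAd e f f = T at *
  generalize M.perpAd e f ⁅e, f⁆ = E at *
  have k₁ := congrArg (fun X => LinearMap.trace ℝ g (S * X)) h₁
  have k₂ := congrArg (fun X => LinearMap.trace ℝ g (T * X)) h₂
  have k₃ := congrArg (fun X => LinearMap.trace ℝ g (T * X)) h₁
  have k₄ := congrArg (fun X => LinearMap.trace ℝ g (S * X)) h₂
  have t₁ : LinearMap.trace ℝ g (S * (S * E)) = LinearMap.trace ℝ g (S * (E * S)) := by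
    rw [LinearMap.trace_mul_comm, ← mul_assoc, mul_assoc]
  have t₂ : LinearMap.trace ℝ g (T * (T * E)) = LinearMap.trace ℝ g (T * (E * T)) := by
    rw [LinearMap.trace_mul_comm, ← mul_assoc, mul_assoc]
  have t₃ : LinearMap.trace ℝ g (T * (S * E)) = LinearMap.trace ℝ g (S * (E * T)) := by
    rw [LinearMap.trace_mul_comm, ← mul_assoc, mul_assoc]
  have t₄ : LinearMap.trace ℝ g (S * (T * E)) = LinearMap.trace ℝ g (T * (E * S)) := by
    rw [LinearMap.trace_mul_comm, ← mul_assoc, mul_assoc]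
  have t₅ : LinearMap.trace ℝ g (T * S) = LinearMap.trace ℝ g (S * T) :=
    LinearMap.trace_mul_comm ℝ T S
  simp only [mul_sub, mul_add, mul_smul_comm, map_sub, map_add, map_smul, smul_eq_mul, t₁, t₂, t₃,
    t₄, t₅] at k₁ k₂ k₃ k₄
  have e₁ : s * (1 - l) * (LinearMap.trace ℝ g (S * S) + LinearMap.trace ℝ g (T * T)) = 0 := by
    linear_combination k₁ - k₂
  have e₂ : s * m * (LinearMap.trace ℝ g (S * S) + LinearMap.trace ℝ g (T * T)) = 0 := by
    linear_combination k₃ + k₄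
  have e₃ : LinearMap.trace ℝ g (S * S) + LinearMap.trace ℝ g (T * T) = 0 := by
    refine (mul_eq_zero.1 ?_).resolve_left hs
    linear_combination (1 - l) * e₁ + m * e₂ -
      s * (LinearMap.trace ℝ g (S * S) + LinearMap.trace ℝ g (T * T)) * hc
  exact ⟨hP0 (by linarith), hR0 (by linarith)⟩

end Algebra

end IsZZFrame

end PseudoEuclideanMetric

/-! ### The three-dimensional factor and its Ricci curvature -/

namespace PseudoEuclideanMetric

namespace IsZZFrame

section Trace

variable {V : Type u} [AddCommGroup V] [Module ℝ V] {M : PseudoEuclideanMetric V}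
  {A : Module.End ℝ V} {α a b : ℝ} {n : ℕ} {v : Fin n → V} {e f : V}

/-- The trace of an endomorphism that vanishes on the vectors orthogonal to `e`, `f` and `x`. -/
theorem trace_of_vanish (F : M.IsZZFrame A α a b v e f) {x : V} (hx : x ∈ M.perp e f)
    (hx0 : M.form x x ≠ 0) {S : Module.End ℝ V}
    (hS : ∀ u ∈ M.perp e f, M.form x u = 0 → S u = 0) :
    LinearMap.trace ℝ V S =
      M.form (S x) x / M.form x x + (M.form (S e) f + M.form (S f) e) := by
  rw [F.trace]
  congr 1
  have hv : ∀ i, S (v i) = (M.form x (v i) / M.form x x) • S x := fun i => by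
    rw [← map_smul, ← sub_eq_zero, ← map_sub]
    refine hS _ (sub_mem (F.mem_perp_v i) (Submodule.smul_mem _ _ hx)) ?_
    rw [map_sub, map_smul, smul_eq_mul, div_mul_cancel₀ _ hx0, sub_self]
  rw [M.form_comm (S x) x, F.form_eq_sum_of_mem_perp hx, Finset.sum_div]
  refine Finset.sum_congr rfl fun i _ => ?_
  rw [hv, map_smul, LinearMap.smul_apply, smul_eq_mul, M.form_comm (S x)]
  ring

end Trace

section Splitting

variable {g : Type u} [LieRing g] [LieAlgebra ℝ g] [FiniteDimensional ℝ g]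
  {M : PseudoEuclideanMetric g} {A : Module.End ℝ g} {α a b : ℝ} {n : ℕ} {v : Fin n → g} {e f : g}
  {l m : ℝ}

theorem lie_perp_e_eq (F : M.IsZZFrame A α a b v e f) (hA : M.IsCodazzi A)
    (hl : l * ((a - α) ^ 2 + b ^ 2) = 2 * b ^ 2)
    (hm : m * ((a - α) ^ 2 + b ^ 2) = 2 * (a - α) * b)
    (hs : M.form (M.leviCivita ⁅e, f⁆ e) f ≠ 0) {u : g} (hu : u ∈ M.perp e f) :
    ⁅u, e⁆ = M.form (M.leviCivita u e) f • ((1 - l) • e + m • f) := by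
  rw [F.lie_perp_e hA hl hm hu, (F.perpAd_null_eq_zero hA hl hm hs).1, LinearMap.zero_apply]
  module

theorem lie_perp_f_eq (F : M.IsZZFrame A α a b v e f) (hA : M.IsCodazzi A)
    (hl : l * ((a - α) ^ 2 + b ^ 2) = 2 * b ^ 2)
    (hm : m * ((a - α) ^ 2 + b ^ 2) = 2 * (a - α) * b)
    (hs : M.form (M.leviCivita ⁅e, f⁆ e) f ≠ 0) {u : g} (hu : u ∈ M.perp e f) :
    ⁅u, f⁆ = M.form (M.leviCivita u e) f • (m • e - (1 - l) • f) := by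
  rw [F.lie_perp_f hA hl hm hu, (F.perpAd_null_eq_zero hA hl hm hs).2, LinearMap.zero_apply]
  module

theorem lie_perp_lie_null (F : M.IsZZFrame A α a b v e f) (hA : M.IsCodazzi A)
    (hl : l * ((a - α) ^ 2 + b ^ 2) = 2 * b ^ 2)
    (hm : m * ((a - α) ^ 2 + b ^ 2) = 2 * (a - α) * b)
    (hs : M.form (M.leviCivita ⁅e, f⁆ e) f ≠ 0) {u : g} (hu : u ∈ M.perp e f) :
    ⁅u, ⁅e, f⁆⁆ = 0 := by
  rw [leibniz_lie, F.lie_perp_e_eq hA hl hm hs hu, F.lie_perp_f_eq hA hl hm hs hu]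
  simp only [smul_lie, lie_smul, add_lie, lie_sub, lie_self]
  module

/-- The operators `ad u`, `u ∈ M.perp e f`, act on the plane spanned by `e` and `f` by multiples of
one fixed nonzero operator, so commutators act trivially. -/
theorem form_lie_null_lie (F : M.IsZZFrame A α a b v e f) (hA : M.IsCodazzi A)
    (hl : l * ((a - α) ^ 2 + b ^ 2) = 2 * b ^ 2)
    (hm : m * ((a - α) ^ 2 + b ^ 2) = 2 * (a - α) * b)
    (hs : M.form (M.leviCivita ⁅e, f⁆ e) f ≠ 0) {u w : g} (hu : u ∈ M.perp e f)
    (hw : w ∈ M.perp e f) : M.form ⁅e, f⁆ ⁅u, w⁆ = 0 := by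
  have huw := F.lie_mem_perp hA hu hw
  have hj : ⁅u, ⁅w, e⁆⁆ = ⁅⁅u, w⁆, e⁆ + ⁅w, ⁅u, e⁆⁆ := leibniz_lie _ _ _
  rw [F.lie_perp_e_eq hA hl hm hs hu, F.lie_perp_e_eq hA hl hm hs hw,
    F.lie_perp_e_eq hA hl hm hs huw] at hj
  simp only [lie_smul, lie_add, F.lie_perp_e_eq hA hl hm hs hu, F.lie_perp_e_eq hA hl hm hs hw,
    F.lie_perp_f_eq hA hl hm hs hu, F.lie_perp_f_eq hA hl hm hs hw] at hj
  have he := congrArg (fun y => M.form y e) hj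
  have hf := congrArg (fun y => M.form y f) hj
  simp only [map_add, map_sub, map_smul, LinearMap.add_apply, LinearMap.sub_apply,
    LinearMap.smul_apply, smul_eq_mul, F.ee, F.ef, F.fe, F.ff] at he hf
  rw [F.form_lie_null hA hl hm huw]
  linear_combination 2 * l * M.form (M.leviCivita ⁅u, w⁆ e) f * F.circle hl hm +
    2 * l * m * he + 2 * l * (1 - l) * hf

theorem leviCivita_perp_lie_null (F : M.IsZZFrame A α a b v e f) (hA : M.IsCodazzi A)
    (hl : l * ((a - α) ^ 2 + b ^ 2) = 2 * b ^ 2)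
    (hm : m * ((a - α) ^ 2 + b ^ 2) = 2 * (a - α) * b)
    (hs : M.form (M.leviCivita ⁅e, f⁆ e) f ≠ 0) {u : g} (hu : u ∈ M.perp e f) :
    M.leviCivita u ⁅e, f⁆ = 0 := by
  have hx := F.lie_null_mem_perp hA
  have hL := mem_perp.1 (F.leviCivita_mem_perp hA hu hx)
  refine F.ext (by simp [hL.1]) (by simp [hL.2]) fun w hw => ?_
  have := M.two_mul_form_leviCivita u ⁅e, f⁆ w
  rw [F.lie_perp_lie_null hA hl hm hs hu, F.lie_perp_lie_null hA hl hm hs hw,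
    M.form_comm ⁅w, u⁆, F.form_lie_null_lie hA hl hm hs hw hu] at this
  simpa using this

theorem leviCivita_lie_null (F : M.IsZZFrame A α a b v e f) (hA : M.IsCodazzi A)
    (hl : l * ((a - α) ^ 2 + b ^ 2) = 2 * b ^ 2)
    (hm : m * ((a - α) ^ 2 + b ^ 2) = 2 * (a - α) * b)
    {s : ℝ} (hs : M.form (M.leviCivita ⁅e, f⁆ e) f = s) (hs0 : s ≠ 0) :
    M.leviCivita e ⁅e, f⁆ = s • (l • e - m • f) ∧ M.leviCivita f ⁅e, f⁆ = -s • (m • e + l • f) := by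
  have hx := F.lie_null_mem_perp hA
  have h₁ := F.leviCivita_perp_e hA hx
  have h₂ := F.leviCivita_perp_f hA hx
  have h₃ := F.lie_perp_e_eq hA hl hm (hs ▸ hs0) hx
  have h₄ := F.lie_perp_f_eq hA hl hm (hs ▸ hs0) hx
  rw [hs] at h₁ h₂ h₃ h₄
  rw [← M.leviCivita_sub_leviCivita ⁅e, f⁆ e, h₁] at h₃
  rw [← M.leviCivita_sub_leviCivita ⁅e, f⁆ f, h₂] at h₄
  constructor
  · linear_combination (norm := module) -h₃
  · linear_combination (norm := module) -h₄

/-- The Levi-Civita product of the plane takes values in the line spanned by `⁅e, f⁆`. -/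
theorem leviCivita_null_null (F : M.IsZZFrame A α a b v e f) (hA : M.IsCodazzi A)
    (hl : l * ((a - α) ^ 2 + b ^ 2) = 2 * b ^ 2)
    (hm : m * ((a - α) ^ 2 + b ^ 2) = 2 * (a - α) * b) (hl0 : l ≠ 0) :
    M.leviCivita e e = -(m / (2 * l)) • ⁅e, f⁆ ∧ M.leviCivita e f = (1 / 2 : ℝ) • ⁅e, f⁆ ∧
    M.leviCivita f e = -(1 / 2 : ℝ) • ⁅e, f⁆ ∧ M.leviCivita f f = -(m / (2 * l)) • ⁅e, f⁆ := by
  obtain ⟨h₁, h₂, h₃, h₄⟩ := F.leviCivita_null_mem_perp hA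
  have hx := mem_perp.1 (F.lie_null_mem_perp hA)
  rw [mem_perp] at h₁ h₂ h₃ h₄
  refine ⟨F.ext (by simp [*]) (by simp [*]) fun u hu => ?_,
    F.ext (by simp [*]) (by simp [*]) fun u hu => ?_,
    F.ext (by simp [*]) (by simp [*]) fun u hu => ?_,
    F.ext (by simp [*]) (by simp [*]) fun u hu => ?_⟩ <;>
  · obtain ⟨k₁, k₂, k₃, k₄⟩ := F.form_leviCivita_null hA hl hm hu
    rw [M.form_leviCivita_skew, map_smul, LinearMap.smul_apply, F.form_lie_null hA hl hm hu]
    simp only [k₁, k₂, k₃, k₄, smul_eq_mul]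
    field_simp

end Splitting

section Ricci

variable {g : Type u} [LieRing g] [LieAlgebra ℝ g] [FiniteDimensional ℝ g]
  {M : PseudoEuclideanMetric g} {α a b : ℝ} {n : ℕ} {v : Fin n → g} {e f : g} {l m : ℝ}

/-- If `e` and `f` commute, then `e` is parallel and `ric(e, e) = 0`, while
`⟨Ric e, e⟩ = -b ≠ 0`. -/
theorem lie_null_ne_zero (F : M.IsZZFrame M.ricciOp α a b v e f) (hA : M.HasHarmonicCurvature)
    (hl : l * ((a - α) ^ 2 + b ^ 2) = 2 * b ^ 2)
    (hm : m * ((a - α) ^ 2 + b ^ 2) = 2 * (a - α) * b) (hl0 : l ≠ 0) : ⁅e, f⁆ ≠ 0 := by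
  intro hx
  obtain ⟨h₁, -, h₃, -⟩ := F.leviCivita_null_null hA hl hm hl0
  have h₄ : ∀ u ∈ M.perp e f, M.leviCivita u e = 0 := fun u hu => by
    have := F.form_lie_null hA hl hm hu
    rw [hx, map_zero, LinearMap.zero_apply, eq_comm, mul_eq_zero] at this
    rw [F.leviCivita_perp_e hA hu, this.resolve_left (by simpa using hl0), zero_smul]
  rw [hx, smul_zero] at h₁ h₃
  have h₅ : ∀ y, M.leviCivita y e = 0 := fun y => by
    rw [F.expand y]
    simp [h₁, h₃, h₄ _ (F.mem_perp_v _)]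
  have h₆ : M.curvatureEnd e e = 0 := LinearMap.ext fun y => by
    simp [curvatureEnd_apply, curvature_apply, h₅]
  have h₇ := M.form_ricciOp e e
  rw [ricci_apply, h₆, map_zero, F.Ae] at h₇
  simp [F.ee, F.fe, F.b_ne] at h₇

theorem form_leviCivita_lie_null (F : M.IsZZFrame M.ricciOp α a b v e f)
    (hA : M.HasHarmonicCurvature)
    (hl : l * ((a - α) ^ 2 + b ^ 2) = 2 * b ^ 2)
    (hm : m * ((a - α) ^ 2 + b ^ 2) = 2 * (a - α) * b) (hl0 : l ≠ 0) :
    M.form (M.leviCivita ⁅e, f⁆ e) f ≠ 0 := by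
  have hx := F.lie_null_mem_perp hA
  have h₁ := F.form_self_pos hx (F.lie_null_ne_zero hA hl hm hl0)
  rw [F.form_lie_null hA hl hm hx] at h₁
  intro h
  rw [h] at h₁
  simp at h₁

/-- The Ricci curvature of the three-dimensional factor spanned by `e`, `f` and `⁅e, f⁆`. -/
theorem ricci_eq (F : M.IsZZFrame M.ricciOp α a b v e f) (hA : M.HasHarmonicCurvature)
    (hl : l * ((a - α) ^ 2 + b ^ 2) = 2 * b ^ 2)
    (hm : m * ((a - α) ^ 2 + b ^ 2) = 2 * (a - α) * b) (hl0 : l ≠ 0)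
    {s : ℝ} (hs : M.form (M.leviCivita ⁅e, f⁆ e) f = s) :
    M.ricci e e = s * m / l ∧ M.ricci e f = -s ∧ M.ricci ⁅e, f⁆ ⁅e, f⁆ = -4 * l * s ^ 2 := by
  have hs0 : s ≠ 0 := hs ▸ F.form_leviCivita_lie_null hA hl hm hl0
  have hx := F.lie_null_mem_perp hA
  have hxe := mem_perp.1 hx
  have hk := F.form_lie_null hA hl hm hx
  rw [hs] at hk
  have hk0 : M.form ⁅e, f⁆ ⁅e, f⁆ ≠ 0 := by rw [hk]; simp [hl0, hs0]
  obtain ⟨Lee, Lef, Lfe, Lff⟩ := F.leviCivita_null_null hA hl hm hl0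
  obtain ⟨Lex, Lfx⟩ := F.leviCivita_lie_null hA hl hm hs hs0
  have Lxe := F.leviCivita_perp_e hA hx
  have Lxf := F.leviCivita_perp_f hA hx
  have Lux : ∀ u ∈ M.perp e f, M.leviCivita u ⁅e, f⁆ = 0 := fun u hu =>
    F.leviCivita_perp_lie_null hA hl hm (hs ▸ hs0) hu
  have Bxe := F.lie_perp_e_eq hA hl hm (hs ▸ hs0) hx
  have Bxf := F.lie_perp_f_eq hA hl hm (hs ▸ hs0) hx
  have Bux : ∀ u ∈ M.perp e f, ⁅u, ⁅e, f⁆⁆ = 0 := fun u hu =>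
    F.lie_perp_lie_null hA hl hm (hs ▸ hs0) hu
  rw [hs] at Lxe Lxf Bxe Bxf
  have hc : ∀ u ∈ M.perp e f, M.form ⁅e, f⁆ u = 0 → M.form (M.leviCivita u e) f = 0 :=
    fun u hu h => by
      rw [F.form_lie_null hA hl hm hu, mul_eq_zero] at h
      exact h.resolve_left (by simpa using hl0)
  have Lue : ∀ u ∈ M.perp e f, M.form ⁅e, f⁆ u = 0 → M.leviCivita u e = 0 := fun u hu h => by
    rw [F.leviCivita_perp_e hA hu, hc u hu h, zero_smul]
  have Luf : ∀ u ∈ M.perp e f, M.form ⁅e, f⁆ u = 0 → M.leviCivita u f = 0 := fun u hu h => by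
    rw [F.leviCivita_perp_f hA hu, hc u hu h, neg_zero, zero_smul]
  have Beu : ∀ u ∈ M.perp e f, M.form ⁅e, f⁆ u = 0 → ⁅e, u⁆ = 0 := fun u hu h => by
    rw [← lie_skew, F.lie_perp_e_eq hA hl hm (hs ▸ hs0) hu, hc u hu h, zero_smul, neg_zero]
  have Bxu : ∀ u ∈ M.perp e f, ⁅⁅e, f⁆, u⁆ = 0 := fun u hu => by
    rw [← lie_skew, Bux u hu, neg_zero]
  have Bex : ⁅e, ⁅e, f⁆⁆ = -(s • ((1 - l) • e + m • f)) := by rw [← lie_skew, Bxe]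
  have hci := F.circle hl hm
  have Bxx : ⁅⁅e, f⁆, ⁅e, f⁆⁆ = 0 := lie_self _
  have Lxx := Lux _ hx
  generalize Bef : ⁅e, f⁆ = x at *
  refine ⟨?_, ?_, ?_⟩
  · rw [ricci_apply, F.trace_of_vanish hx hk0 fun u hu h => by
      simp [curvatureEnd_apply, curvature_apply, Beu u hu h, Lue u hu h, Lee, Lux u hu]]
    simp only [curvatureEnd_apply, curvature_apply, Bef, Bex, lie_self, map_neg, map_smul, map_add,
      map_sub, LinearMap.neg_apply, LinearMap.smul_apply, LinearMap.add_apply,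
      LinearMap.sub_apply, Lee, Lfe, Lex, Lfx, Lxe, Lxx, map_zero,
      LinearMap.zero_apply, smul_eq_mul, F.ee, F.ef, F.fe, F.ff]
    field_simp
    ring
  · rw [ricci_apply, F.trace_of_vanish hx hk0 fun u hu h => by
      simp [curvatureEnd_apply, curvature_apply, Beu u hu h, Luf u hu h, Lef, Lux u hu]]
    simp only [curvatureEnd_apply, curvature_apply, Bef, Bex, lie_self, map_neg, map_smul, map_add,
      map_sub, LinearMap.neg_apply, LinearMap.smul_apply, LinearMap.add_apply,
      LinearMap.sub_apply, Lef, Lff, Lex, Lfx, Lxf, Lxx, map_zero,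
      LinearMap.zero_apply, smul_eq_mul, F.ee, F.ef, F.fe, F.ff]
    field_simp
    ring
  · rw [ricci_apply, F.trace_of_vanish hx hk0 fun u hu h => by
      simp [curvatureEnd_apply, curvature_apply, Bxu u hu, Lux u hu, Lxx]]
    simp only [curvatureEnd_apply, curvature_apply, Bxe, Bxf, Bxx, map_smul, map_add,
      map_sub, LinearMap.smul_apply, LinearMap.add_apply, LinearMap.sub_apply, Lex, Lfx, Lxe, Lxf,
      Lxx, map_zero, LinearMap.zero_apply, smul_eq_mul, F.ee, F.ef, F.fe, F.ff]
    field_simp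
    linear_combination -2 * M.form x x * s ^ 2 * hci

end Ricci

end IsZZFrame

end PseudoEuclideanMetric

/-! ### The isomorphism with `sl(2,ℝ)` times an Einstein factor -/

namespace PseudoEuclideanMetric

section Isometries

variable {g : Type u} [LieRing g] [LieAlgebra ℝ g] {h : Type v} [LieRing h] [LieAlgebra ℝ h]
  {M : PseudoEuclideanMetric g} {N : PseudoEuclideanMetric h}

theorem Isomorphic.symm (hMN : M.Isomorphic N) : N.Isomorphic M := by
  obtain ⟨φ, hφ⟩ := hMN
  exact ⟨φ.symm, fun x y => by rw [← hφ, φ.apply_symm_apply, φ.apply_symm_apply]⟩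

/-- A homomorphism preserving the metrics is injective, by nondegeneracy. -/
theorem exists_lieEquiv_of_surjective (ψ : g →ₗ⁅ℝ⁆ h)
    (hψ : ∀ x y, N.form (ψ x) (ψ y) = M.form x y) (hs : Function.Surjective ψ) :
    ∃ φ : g ≃ₗ⁅ℝ⁆ h, ∀ x, φ x = ψ x := by
  have hi : Function.Injective ψ := fun x y hxy =>
    M.eq_of_form_eq fun w => by rw [← hψ, ← hψ, hxy]
  exact ⟨LieEquiv.ofBijective ψ ⟨hi, hs⟩, fun _ => rfl⟩

theorem Isomorphic.of_prod_subsingleton {k : Type*} [LieRing k] [LieAlgebra ℝ k] [Subsingleton k]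
    {K : PseudoEuclideanMetric k} (hM : M.Isomorphic (N.prod K)) : M.Isomorphic N := by
  obtain ⟨φ, hφ⟩ := hM
  refine ⟨φ.trans (LieEquiv.ofBijective (LieHom.fst ℝ h k) ⟨?_, Prod.fst_surjective⟩), ?_⟩
  · exact fun x y hxy => Prod.ext hxy (Subsingleton.elim _ _)
  · intro x y
    rw [← hφ, prod_form_apply, Subsingleton.elim (φ x).2 0, map_zero, LinearMap.zero_apply,
      add_zero]
    rfl

end Isometries

/-- The restriction of a metric to a subspace on which it is positive definite. -/
noncomputable def restrict {V : Type u} [AddCommGroup V] [Module ℝ V]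
    (M : PseudoEuclideanMetric V) (W : Submodule ℝ V)
    (hW : ∀ x ∈ W, x ≠ 0 → 0 < M.form x x) : PseudoEuclideanMetric W where
  form := M.form.restrict W
  symm := ⟨fun x y => M.symm.eq x y⟩
  nondeg := by
    have key : ∀ x : W, M.form x x = 0 → x = 0 := fun x hx => by
      by_contra h
      exact (hW x x.2 (by simpa using h)).ne' hx
    exact ⟨fun x h => key x (h x), fun x h => key x (h x)⟩

/-- Vectors `e`, `f`, `x` with the given brackets and scalar products span a copy of `sl(2,ℝ)`
with the metric `SlTwo.metric α`. -/
theorem exists_slTwo_hom {g : Type u} [LieRing g] [LieAlgebra ℝ g] (M : PseudoEuclideanMetric g)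
    {α m : ℝ} (hα : α < 0) (hm : 0 < m) (hm2 : m ^ 2 = 3 / 4) {e f x : g}
    (ee : M.form e e = 0) (ff : M.form f f = 0) (ef : M.form e f = 1)
    (xe : M.form x e = 0) (xf : M.form x f = 0) (xx : M.form x x = -α / 2)
    (lef : ⁅e, f⁆ = x) (lxe : ⁅x, e⁆ = (α / 2) • ((1 / 2 : ℝ) • e + m • f))
    (lxf : ⁅x, f⁆ = (α / 2) • (m • e - (1 / 2 : ℝ) • f)) :
    ∃ ψ : SlTwo →ₗ⁅ℝ⁆ g, (∀ y z, M.form (ψ y) (ψ z) = (SlTwo.metric α hα).form y z) ∧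
      (∀ y, ψ y ∈ Submodule.span ℝ {e, f, x}) ∧ (∃ y, ψ y = e) ∧ (∃ y, ψ y = f) ∧
      ∃ y, ψ y = x := by
  have hα0 := hα.ne
  obtain ⟨r, hr0, hr⟩ : ∃ r : ℝ, r ≠ 0 ∧ r ^ 2 * m * α = -8 := by
    have : 0 < -8 / (m * α) := div_pos_of_neg_of_neg (by norm_num) (mul_neg_of_pos_of_neg hm hα)
    refine ⟨√(-8 / (m * α)), (Real.sqrt_pos.2 this).ne', ?_⟩
    rw [Real.sq_sqrt this.le]
    field_simp
  have hr' : r ^ 2 * m = -8 / α := by field_simp; linarith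
  have hm0 := hm.ne'
  -- The null vectors `X₃` and `X₁ + X₃ / 2` are sent to `r e` and `-m r f`. The image of `X₂` is
  -- `(4 / α) x`, as `ad X₂` has eigenvalues `±2` and `ad x` has eigenvalues `±α / 2`.
  let T : SlTwo →ₗ[ℝ] g :=
    SlTwo.basis.constr ℝ ![-(r / 2) • e - (m * r) • f, (4 / α) • x, r • e]
  have hT : ∀ c, T (SlTwo.ofCoords c) =
      (r * c 2 - r / 2 * c 0) • e - (m * r * c 0) • f + (4 / α * c 1) • x := fun c => by
    simp only [T, Module.Basis.constr_apply_fintype, Module.Basis.equivFun_apply,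
      SlTwo.basis_repr_ofCoords, Fin.sum_univ_three]
    simp only [Matrix.cons_val]
    module
  have lfe : ⁅f, e⁆ = -x := by rw [← lie_skew, lef]
  have lex : ⁅e, x⁆ = -((α / 2) • ((1 / 2 : ℝ) • e + m • f)) := by rw [← lie_skew, lxe]
  have lfx : ⁅f, x⁆ = -((α / 2) • (m • e - (1 / 2 : ℝ) • f)) := by rw [← lie_skew, lxf]
  have fe : M.form f e = 1 := by rw [M.form_comm, ef]
  have ex : M.form e x = 0 := by rw [M.form_comm, xe]
  have fx : M.form f x = 0 := by rw [M.form_comm, xf]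
  refine ⟨{ T with map_lie' := ?_ }, ?_, ?_, ⟨SlTwo.ofCoords ![0, 0, r⁻¹], ?_⟩,
    ⟨SlTwo.ofCoords ![-(m * r)⁻¹, 0, -(2 * m * r)⁻¹], ?_⟩, ⟨SlTwo.ofCoords ![0, α / 4, 0], ?_⟩⟩
  · intro y z
    obtain ⟨c, rfl⟩ := SlTwo.ofCoords_surjective y
    obtain ⟨d, rfl⟩ := SlTwo.ofCoords_surjective z
    change T ⁅SlTwo.ofCoords c, SlTwo.ofCoords d⁆ = ⁅T (SlTwo.ofCoords c), T (SlTwo.ofCoords d)⁆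
    rw [SlTwo.lie_ofCoords, hT, hT, hT]
    simp only [add_lie, sub_lie, lie_add, lie_sub, smul_lie, lie_smul, lie_self, lef, lfe, lxe,
      lex, lxf, lfx, Matrix.cons_val]
    match_scalars
    · field_simp
      linear_combination -16 * (c 0 * d 1 - c 1 * d 0) * hm2
    · field_simp
      ring
    · field_simp
      linear_combination -2 * (c 0 * d 2 - c 2 * d 0) * hr
  · intro y z
    obtain ⟨c, rfl⟩ := SlTwo.ofCoords_surjective y
    obtain ⟨d, rfl⟩ := SlTwo.ofCoords_surjective z
    change M.form (T (SlTwo.ofCoords c)) (T (SlTwo.ofCoords d)) = _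
    rw [hT, hT, SlTwo.metric_form_ofCoords]
    simp only [map_add, map_sub, map_smul, LinearMap.add_apply, LinearMap.sub_apply,
      LinearMap.smul_apply, smul_eq_mul, ee, ff, ef, fe, xe, ex, xf, fx, xx]
    field_simp
    linear_combination -4 * (c 0 * d 2 + c 2 * d 0 - c 0 * d 0) * hr
  · intro y
    obtain ⟨c, rfl⟩ := SlTwo.ofCoords_surjective y
    change T (SlTwo.ofCoords c) ∈ _
    rw [hT]
    refine add_mem (sub_mem ?_ ?_) ?_ <;> refine Submodule.smul_mem _ _ (Submodule.subset_span ?_)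
    · exact Set.mem_insert _ _
    · exact Set.mem_insert_of_mem _ (Set.mem_insert _ _)
    · exact Set.mem_insert_of_mem _ (Set.mem_insert_of_mem _ rfl)
  all_goals
    refine (hT _).trans ?_
    simp only [Matrix.cons_val]
    match_scalars <;> field_simp <;> ring

namespace IsZZFrame

variable {g : Type u} [LieRing g] [LieAlgebra ℝ g] [FiniteDimensional ℝ g]
  {M : PseudoEuclideanMetric g} {α a b : ℝ} {n : ℕ} {v : Fin n → g} {e f : g} {l m : ℝ}

/-- The Ricci curvature of the three-dimensional factor determines all structure constants. -/
theorem constants (F : M.IsZZFrame M.ricciOp α a b v e f) (hA : M.HasHarmonicCurvature)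
    (hl : l * ((a - α) ^ 2 + b ^ 2) = 2 * b ^ 2)
    (hm : m * ((a - α) ^ 2 + b ^ 2) = 2 * (a - α) * b) :
    α < 0 ∧ l = 1 / 2 ∧ m * α = -b ∧ m ^ 2 = 3 / 4 ∧
      M.form (M.leviCivita ⁅e, f⁆ e) f = α / 2 ∧ M.form ⁅e, f⁆ ⁅e, f⁆ = -α / 2 := by
  have hb := F.b_ne
  have hN := F.norm_pos
  have hl0 : l ≠ 0 := by
    rintro rfl
    simp [hb] at hl
  have hx := F.lie_null_mem_perp hA
  have hs0 := F.form_leviCivita_lie_null hA hl hm hl0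
  have hpos := F.form_self_pos hx (F.lie_null_ne_zero hA hl hm hl0)
  obtain ⟨h₁, h₂, h₃⟩ := F.ricci_eq hA hl hm hl0 rfl
  have hk := F.form_lie_null hA hl hm hx
  rw [← M.form_ricciOp, F.Ae] at h₁ h₂
  rw [← M.form_ricciOp, F.apply_of_mem_perp hx] at h₃
  simp only [map_sub, map_smul, LinearMap.sub_apply, LinearMap.smul_apply, smul_eq_mul, F.ee, F.ef,
    F.fe, F.ff] at h₁ h₂ h₃
  rw [hk] at h₃ hpos ⊢
  generalize M.form (M.leviCivita ⁅e, f⁆ e) f = s at *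
  have hαs : α = 2 * s := by
    have : l * s * (α - 2 * s) = 0 := by linear_combination -(1 / 2) * h₃
    have := (mul_eq_zero.1 this).resolve_left (mul_ne_zero hl0 hs0)
    linarith
  have has : a = -s := by linarith
  subst hαs has
  have h₄ : s * m = -b * l := by
    field_simp at h₁
    linarith
  have h₅ : b ^ 2 = 3 * s ^ 2 := by
    have : b * (b ^ 2 - 3 * s ^ 2) = 0 := by
      linear_combination (1 / 2) * ((-s - 2 * s) ^ 2 + b ^ 2) * h₄ - s / 2 * hm - b / 2 * hl
    have := (mul_eq_zero.1 this).resolve_left hb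
    linarith
  rw [h₅] at hl
  have h₆ : l = 1 / 2 := by
    refine mul_right_cancel₀ (pow_ne_zero 2 hs0) ?_
    linear_combination (1 / 12) * hl
  subst h₆
  have h₇ : m * (2 * s) = -b := by linarith
  refine ⟨by linarith, rfl, h₇, ?_, by ring, by ring⟩
  refine mul_right_cancel₀ (pow_ne_zero 2 hs0) ?_
  linear_combination (1 / 4) * (m * (2 * s) - b) * h₇ + (1 / 4) * h₅

theorem exists_constants (F : M.IsZZFrame M.ricciOp α a b v e f) :
    ∃ l m : ℝ, l * ((a - α) ^ 2 + b ^ 2) = 2 * b ^ 2 ∧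
      m * ((a - α) ^ 2 + b ^ 2) = 2 * (a - α) * b :=
  ⟨_, _, div_mul_cancel₀ _ F.norm_pos.ne', div_mul_cancel₀ _ F.norm_pos.ne'⟩

theorem not_isRicciParallel (F : M.IsZZFrame M.ricciOp α a b v e f)
    (hA : M.HasHarmonicCurvature) : ¬ M.IsRicciParallel := by
  intro hp
  obtain ⟨l, m, hl, hm⟩ := F.exists_constants
  obtain ⟨hα, -, -, -, hs, -⟩ := F.constants hA hl hm
  have hx := F.lie_null_mem_perp hA
  have h := hp ⁅e, f⁆ e
  rw [F.Ae, F.leviCivita_perp_e hA hx, map_sub, map_smul, map_smul, F.leviCivita_perp_e hA hx,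
    F.leviCivita_perp_f hA hx, map_smul, F.Ae, hs] at h
  have := congrArg (fun y => M.form y e) h
  simp only [map_sub, map_smul, LinearMap.sub_apply, LinearMap.smul_apply, smul_eq_mul, F.ee,
    F.ef, F.fe] at this
  have h₀ : α * b = 0 := by linarith
  exact (mul_ne_zero hα.ne F.b_ne) h₀

/-- Here `H` is the orthogonal complement of `e`, `f` and `⁅e, f⁆`; it commutes with these three
vectors. -/
theorem exists_isomorphic_prod_of_pos (F : M.IsZZFrame M.ricciOp α a b v e f)
    (hA : M.HasHarmonicCurvature) (hb : 0 < b) :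
    ∃ hα : α < 0, ∃ (H : LieSubalgebra ℝ g) (N : PseudoEuclideanMetric H), N.IsEuclidean ∧
      N.IsEinstein α ∧ M.Isomorphic ((SlTwo.metric α hα).prod N) := by
  obtain ⟨l, m, hl, hm⟩ := F.exists_constants
  obtain ⟨hα, hl2, hmb, hm2, hs, hxx⟩ := F.constants hA hl hm
  have hm0 : 0 < m := by nlinarith
  have hx := F.lie_null_mem_perp hA
  have hxe := mem_perp.1 hx
  have hs0 : M.form (M.leviCivita ⁅e, f⁆ e) f ≠ 0 := by rw [hs]; exact (by linarith : α / 2 < 0).ne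
  have lxe := F.lie_perp_e_eq hA hl hm hs0 hx
  have lxf := F.lie_perp_f_eq hA hl hm hs0 hx
  have hnn := fun {u w : g} => F.form_lie_null_lie hA hl hm hs0 (u := u) (w := w)
  have hhx := fun {u : g} => F.lie_perp_lie_null hA hl hm hs0 (u := u)
  have hc : ∀ u ∈ M.perp e f, M.form ⁅e, f⁆ u = 0 → M.form (M.leviCivita u e) f = 0 :=
    fun u hu h => by
      rw [F.form_lie_null hA hl hm hu, hl2] at h
      linarith
  have hhe : ∀ u ∈ M.perp e f, M.form ⁅e, f⁆ u = 0 → ⁅u, e⁆ = 0 := fun u hu h => by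
    rw [F.lie_perp_e_eq hA hl hm hs0 hu, hc u hu h, zero_smul]
  have hhf : ∀ u ∈ M.perp e f, M.form ⁅e, f⁆ u = 0 → ⁅u, f⁆ = 0 := fun u hu h => by
    rw [F.lie_perp_f_eq hA hl hm hs0 hu, hc u hu h, zero_smul]
  rw [hs, show 1 - l = 1 / 2 by rw [hl2]; norm_num] at lxe lxf
  refine ⟨hα, ?_⟩
  generalize lef : ⁅e, f⁆ = x at *
  obtain ⟨ψ, hψ, hspan, ⟨ye, hye⟩, ⟨yf, hyf⟩, ⟨yx, hyx⟩⟩ :=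
    M.exists_slTwo_hom hα hm0 hm2 F.ee F.ff F.ef hxe.1 hxe.2 hxx lef lxe lxf
  obtain ⟨H, hH⟩ : ∃ H : LieSubalgebra ℝ g, ∀ y, y ∈ H ↔ y ∈ M.perp e f ∧ M.form x y = 0 :=
    ⟨{ M.perp e f ⊓ LinearMap.ker (M.form x) with
        lie_mem' := fun {u w} hu hw => ⟨F.lie_mem_perp hA hu.1 hw.1, hnn hu.1 hw.1⟩ },
      fun y => Iff.rfl⟩
  have hpos : ∀ y ∈ H.toSubmodule, y ≠ 0 → 0 < M.form y y := fun y hy =>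
    F.form_self_pos ((hH y).1 hy).1
  have horth : ∀ y, ∀ u ∈ H, M.form (ψ y) u = 0 := fun y u hu => by
    have hu' := (hH u).1 hu
    have hue := mem_perp.1 hu'.1
    have hy := hspan y
    generalize ψ y = z at hy ⊢
    induction hy using Submodule.span_induction with
    | mem z hz =>
      rcases hz with rfl | rfl | rfl
      · rw [M.form_comm, hue.1]
      · rw [M.form_comm, hue.2]
      · exact hu'.2
    | zero => simp
    | add z w _ _ hz hw => rw [map_add, LinearMap.add_apply, hz, hw, add_zero]
    | smul c z _ hz => rw [map_smul, LinearMap.smul_apply, hz, smul_zero]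
  have hcomm : ∀ y, ∀ u ∈ H, ⁅u, ψ y⁆ = 0 := fun y u hu => by
    have hu' := (hH u).1 hu
    have hy := hspan y
    generalize ψ y = z at hy ⊢
    induction hy using Submodule.span_induction with
    | mem z hz =>
      rcases hz with rfl | rfl | rfl
      · exact hhe u hu'.1 hu'.2
      · exact hhf u hu'.1 hu'.2
      · exact hhx hu'.1
    | zero => simp
    | add z w _ _ hz hw => rw [lie_add, hz, hw, add_zero]
    | smul c z _ hz => rw [lie_smul, hz, smul_zero]
  let N : PseudoEuclideanMetric H := M.restrict H.toSubmodule hpos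
  have hN : ∀ y z : H, N.form y z = M.form y z := fun _ _ => rfl
  let Ψ : SlTwo × H →ₗ⁅ℝ⁆ g :=
    { toFun := fun y => ψ y.1 + y.2
      map_add' := fun y z => by
        rw [Prod.fst_add, Prod.snd_add, map_add, AddMemClass.coe_add]
        abel
      map_smul' := fun c y => by simp
      map_lie' := fun {y z} => by
        have h₁ := hcomm y.1 z.2 z.2.2
        have h₂ := hcomm z.1 y.2 y.2.2
        rw [← lie_skew, neg_eq_zero] at h₁
        simp [LieAlgebra.Prod.bracket_apply, h₁, h₂] }
  have hΨ : ∀ y, Ψ y = ψ y.1 + y.2 := fun _ => rfl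
  have hΨiso : ∀ y z, M.form (Ψ y) (Ψ z) = ((SlTwo.metric α hα).prod N).form y z := fun y z => by
    rw [hΨ, hΨ, prod_form_apply, hN, ← hψ]
    have h₁ := horth y.1 z.2 z.2.2
    have h₂ := horth z.1 y.2 y.2.2
    rw [M.form_comm] at h₂
    simp [h₁, h₂]
  obtain ⟨φ, hφ⟩ : ∃ φ : (SlTwo × H) ≃ₗ⁅ℝ⁆ g, ∀ y, φ y = Ψ y := by
    refine exists_lieEquiv_of_surjective Ψ hΨiso fun y => ?_
    · have hxx0 : M.form x x ≠ 0 := by rw [hxx]; linarith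
      let c := M.form x y / M.form x x
      have hu : M.perpProj e f y - c • x ∈ H := by
        rw [hH]
        refine ⟨sub_mem (F.perpProj_mem y) (Submodule.smul_mem _ _ hx), ?_⟩
        rw [map_sub, M.form_comm x, form_perpProj _ hx, map_smul, smul_eq_mul,
          div_mul_cancel₀ _ hxx0, M.form_comm x y, sub_self]
      refine ⟨(M.form y f • ye + M.form y e • yf + c • yx, ⟨_, hu⟩), ?_⟩
      rw [hΨ]
      simp only [map_add, map_smul, hye, hyf, hyx, perpProj_apply]
      module
  have hφiso : ∀ y z, M.form (φ y) (φ z) = ((SlTwo.metric α hα).prod N).form y z := fun y z => by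
    rw [hφ, hφ, hΨiso]
  refine ⟨H, N, fun y hy => hpos y y.2 (by simpa using hy), LinearMap.ext fun y => ?_,
    Isomorphic.symm ⟨φ, hφiso⟩⟩
  have h₁ := ricciOp_map φ hφiso (0, y)
  have h₂ : φ (0, y) = y := by rw [hφ, hΨ, map_zero, zero_add]
  rw [h₂, F.apply_of_mem_perp ((hH y).1 y.2).1, ← h₂, ← map_smul φ, ricciOp_prod] at h₁
  exact (congrArg Prod.snd (φ.injective h₁)).symm

/-- The condition `0 < b` is no restriction, as exchanging `e` and `f` changes the sign of `b`. -/
theorem exists_isomorphic_prod (F : M.IsZZFrame M.ricciOp α a b v e f)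
    (hA : M.HasHarmonicCurvature) :
    ∃ hα : α < 0, ∃ (H : LieSubalgebra ℝ g) (N : PseudoEuclideanMetric H), N.IsEuclidean ∧
      N.IsEinstein α ∧ M.Isomorphic ((SlTwo.metric α hα).prod N) := by
  rcases F.b_ne.lt_or_gt with hb | hb
  · exact F.swap.exists_isomorphic_prod_of_pos hA (neg_pos.2 hb)
  · exact F.exists_isomorphic_prod_of_pos hA hb

end IsZZFrame

end PseudoEuclideanMetric

theorem theorem4p1 {g : Type u} [LieRing g] [LieAlgebra ℝ g] [FiniteDimensional ℝ g]
    (M : PseudoEuclideanMetric g) (hM : M.IsLorentzian)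
    (hdim : 3 ≤ Module.finrank ℝ g)
    (htype : M.IsTypeZZ M.ricciOp)
    (α : ℝ) (hα : ∀ r : ℝ, Module.End.HasEigenvalue M.ricciOp r ↔ r = α) :
    (M.HasHarmonicCurvature ↔
      (Module.finrank ℝ g = 3 ∧ ∃ hneg : α < 0, M.Isomorphic (SlTwo.metric α hneg)) ∨
      (3 < Module.finrank ℝ g ∧ ∃ hneg : α < 0,
        ∃ (h : Type u) (_ : LieRing h) (_ : LieAlgebra ℝ h) (_ : FiniteDimensional ℝ h)
          (N : PseudoEuclideanMetric h),
          N.IsEuclidean ∧ N.IsEinstein α ∧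
            M.Isomorphic ((SlTwo.metric α hneg).prod N))) ∧
    (M.HasHarmonicCurvature → ¬ M.IsRicciParallel) := by
  obtain ⟨n, a, b, v, e, f, F⟩ := htype.exists_isZZFrame fun r => (hα r).1
  refine ⟨⟨fun hA => ?_, ?_⟩, F.not_isRicciParallel⟩
  · obtain ⟨hneg, H, N, hN, hE, hiso⟩ := F.exists_isomorphic_prod hA
    rcases hdim.eq_or_lt with h3 | h3
    · refine .inl ⟨h3.symm, hneg, ?_⟩
      have : Subsingleton H := by
        obtain ⟨φ, -⟩ := hiso
        have h₁ := φ.toLinearEquiv.finrank_eq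
        have h₂ : Module.finrank ℝ SlTwo = 3 := Module.finrank_eq_card_basis SlTwo.basis
        rw [Module.finrank_prod, h₂] at h₁
        exact Module.finrank_zero_iff.1 (by omega : Module.finrank ℝ H = 0)
      exact hiso.of_prod_subsingleton
    · exact .inr ⟨h3, hneg, H, inferInstance, inferInstance, inferInstance, N, hN, hE, hiso⟩
  · rintro (⟨-, hneg, hiso⟩ | ⟨-, hneg, h, _, _, _, N, -, hE, hiso⟩)
    · exact hiso.hasHarmonicCurvature (SlTwo.hasHarmonicCurvature_metric α hneg)
    · exact hiso.hasHarmonicCurvature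
        ((SlTwo.hasHarmonicCurvature_metric α hneg).prod hE.hasHarmonicCurvature)
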